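/- Let $\gamma>0$, $T_0>0$ and $\alpha\in\mathbb R$, and write $\mathbb R^+=[0,\infty)$. Let $u_0\in C_b^2(\mathbb R^+)$ (that is, $u_0\in C^2(\mathbb R^+)$ with $u_0,u_0',u_0''$ bounded) with $u_0'\in L^1(\mathbb R^+)$, let $g\in C([0,\infty))$ be real-valued with $g(0)=0$, and let $f\in C([0,\infty);L^1(\mathbb R^+))$ be real-valued. Assume that $\alpha\neq 0$ or $f\equiv 0$. Assume that $g$ and $f$ are periodic in $t$ of period $T_0$: $g(t+T_0)=g(t)$ and $f(\cdot,t+T_0)=f(\cdot,t)$ in $L^1(\mathbb R^+)$ for all $t\ge 0$. Let $u$ be the solution of the initial- and boundary-value problem for the linearized BBM equation $$u_t+\alpha u_x-\gamma u_{xxt}=f\quad(x\ge0,\ t\ge 0),\qquad u(x,0)=u_0(x)\quad(x\ge 0),\qquad u(0,t)=g(t)\quad(t\ge0),$$ in the following sense: $u$ is a real-valued continuous function on $[0,\infty)\times[0,\infty)$, it is bounded on $[0,\infty)\times[0,T]$ for every $T>0$, the initial and boundary conditions hold pointwise, and for every $\varphi\in C_c^\infty((0,\infty))$ and every $t\ge0$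 the following derivative (one-sided at $t=0$) exists and satisfies $$\frac{d}{dt}\int_0^\infty u(x,t)\,\bigl(\varphi(x)-\gamma\varphi''(x)\bigr)\,dx=\alpha\int_0^\infty u(x,t)\,\varphi'(x)\,dx+\int_0^\infty f(x,t)\,\varphi(x)\,dx .$$ Then, for every fixed $x>0$, $$\lim_{t\to\infty}\bigl(u(x,t+T_0)-u(x,t)\bigr)=0,$$ that is, $u$ is eventually periodic of period $T_0$. -/

import Mathlib

open MeasureTheory Set Filter Topology
open scoped ContDiff

/-- `C_b^k` on the half line `[0, ∞)`: the function is `C^k` up to the boundary point, and it and its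
first `k` derivatives (one-sided at `0`) are bounded. -/
def IsCbHalfLine (k : ℕ) (v : ℝ → ℝ) : Prop :=
  ContDiffOn ℝ k v (Ici 0) ∧
    ∀ j : ℕ, j ≤ k → ∃ C : ℝ, ∀ x ∈ Ici (0 : ℝ), |iteratedDerivWithin j v (Ici 0) x| ≤ C

/-- The Banach space `L¹` of the half line `[0, ∞)` with Lebesgue measure. -/
abbrev L1HalfLine : Type := Lp ℝ 1 (volume.restrict (Ici (0 : ℝ)))

/-- `u = u(x, t)` is a (global in time) solution of the initial-boundary value problem
`u_t + α u_x - γ u_xxt = f` for `x, t ≥ 0`, `u(x, 0) = u₀(x)`, `u(0, t) = g(t)`: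
it is continuous on the closed quarter plane, bounded on `[0, ∞) × [0, T]` for every `T`, takes
the initial and the boundary values pointwise, and at every time `t ≥ 0` satisfies the equation
in the sense of distributions on `(0, ∞)`. -/
structure IsLinearBBMSolution (α γ : ℝ) (f : ℝ → L1HalfLine) (u₀ g : ℝ → ℝ)
    (u : ℝ → ℝ → ℝ) : Prop where
  continuousOn : ContinuousOn (fun p : ℝ × ℝ => u p.1 p.2) (Ici 0 ×ˢ Ici 0)
  bounded : ∀ T : ℝ, ∃ C : ℝ, ∀ x ∈ Ici (0 : ℝ), ∀ t ∈ Icc 0 T, |u x t| ≤ C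
  initial : ∀ x ∈ Ici (0 : ℝ), u x 0 = u₀ x
  boundary : ∀ t ∈ Ici (0 : ℝ), u 0 t = g t
  equation : ∀ φ : ℝ → ℝ, ContDiff ℝ ∞ φ → HasCompactSupport φ → tsupport φ ⊆ Ioi 0 →
    ∀ t ∈ Ici (0 : ℝ),
      HasDerivWithinAt
        (fun s => ∫ x in Ici (0 : ℝ), u x s * (φ x - γ * iteratedDeriv 2 φ x))
        (α * (∫ x in Ici (0 : ℝ), u x t * deriv φ x) + ∫ x in Ici (0 : ℝ), f t x * φ x)
        (Ici 0) t

/-!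
The idea: the time difference `w(x, t) = u(x, t + T₀) - u(x, t)` solves the homogeneous equation
`w_t + α w_x - γ w_xxt = 0` with `w(0, t) = 0`, and this dispersive flow moves all its energy away
from every bounded set. No explicit solution formula is needed.

Put `κ = γ^{-1/2}` and factor `1 - γ ∂² = (1 + κ⁻¹∂)(1 - κ⁻¹∂)`, with half-line inverses `fwd` (zero
boundary value) and `bwd` (bounded solution). Testing the equation against the test functions
`φ - γ φ''`, whose orthogonal complement is spanned by `e^{±κx}`, turns the distributional equation
into the mild form `IsLinearBBMSolution.mild`. Over one period the contributions of `g` cancel and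
that of `f` is constant, so `w = fwd h` where `h_t = α κ (w - q)`, `q = bwd w`
(`IsLinearBBMSolution.isReducedFlow_periodReduced`). The hypothesis `u₀' ∈ L¹`, with Grönwall's
inequality for `∫ |u - u₀|` on `[0, X]`, shows that `h(·, 0)` is square integrable
(`IsLinearBBMSolution.exists_integral_sq_periodReduced_le`).

Decay rests on two local conservation laws. The first, `h h_t = α ∂_x (w² / 2 - w q)`, has no
boundary flux, so `∫ h² = ∫ w² + γ ∫ w_x²` is conserved and `w` is uniformly bounded and
equicontinuous in `x`. The second,
`w w_t = -α ∂_x (q v + q² / 2)` with `v = w_t / (α κ)` and `v(0, t) = 0`,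
gives `d/dt ∫ w² = α q(0, t)²`. As `∫ w²` is bounded by the energy, `q(0, ·)` is square integrable
in time; its derivative is bounded, so `q(0, t) → 0` by Barbalat's lemma. For `s ≠ κ` the Laplace
transform `ŵ(s, t)` in `x` satisfies a scalar equation `ŵ_t = λ ŵ + μ q(0, t)` with real `λ ≠ 0`.
Being bounded, it tends to `0`, whether that equation is stable or unstable
(`tendsto_zero_of_linear_ode`). Finally the moments `ŵ(nκ, t)`, `n ≥ 2`, detect pointwise values by
Weierstrass approximation in the variable `e^{-κx}` (`tendsto_zero_of_tendsto_exp_moments`).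

If `α = 0`, then `f = 0` as well and `w` vanishes identically.
-/

/-! ### The first-order resolvents of the half line -/

theorem integrableOn_exp_neg_mul {s : ℝ} (hs : 0 < s) (a : ℝ) :
    IntegrableOn (fun y => Real.exp (-s * y)) (Ioi a) :=
  integrableOn_exp_mul_Ioi (neg_lt_zero.2 hs) a

theorem integral_exp_neg_mul {s : ℝ} (hs : 0 < s) (a : ℝ) :
    ∫ y in Ioi a, Real.exp (-s * y) = Real.exp (-s * a) / s := by
  rw [integral_exp_mul_Ioi (neg_lt_zero.2 hs) a, neg_div_neg_eq]

theorem integrableOn_exp_mul_of_bounded {s C a : ℝ} (hs : 0 < s) {p : ℝ → ℝ} (hp : Continuous p)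
    (hC : ∀ y, a ≤ y → |p y| ≤ C) : IntegrableOn (fun y => Real.exp (-s * y) * p y) (Ioi a) := by
  refine Integrable.mono' ((integrableOn_exp_neg_mul hs a).mul_const C) (by fun_prop) ?_
  refine (ae_restrict_mem measurableSet_Ioi).mono fun y hy => ?_
  rw [Real.norm_eq_abs, abs_mul, Real.abs_exp]
  exact mul_le_mul_of_nonneg_left (hC y (le_of_lt hy)) (Real.exp_pos _).le

theorem abs_integral_exp_mul_le {s C a : ℝ} (hs : 0 < s) {p : ℝ → ℝ}
    (hC : ∀ y, a ≤ y → |p y| ≤ C) :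
    |∫ y in Ioi a, Real.exp (-s * y) * p y| ≤ Real.exp (-s * a) / s * C := by
  rw [← integral_exp_neg_mul hs, ← integral_mul_const, ← Real.norm_eq_abs]
  refine norm_integral_le_of_norm_le ((integrableOn_exp_neg_mul hs a).mul_const C) ?_
  refine (ae_restrict_mem measurableSet_Ioi).mono fun y hy => ?_
  rw [Real.norm_eq_abs, abs_mul, Real.abs_exp]
  exact mul_le_mul_of_nonneg_left (hC y (le_of_lt hy)) (Real.exp_pos _).le

/-- The causal resolvent `(1 + κ⁻¹ ∂)⁻¹` on the half line: the solution `y` of `y' = κ (p - y)` with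
`y 0 = 0`. -/
noncomputable def fwd (κ : ℝ) (p : ℝ → ℝ) (x : ℝ) : ℝ :=
  κ * Real.exp (-κ * x) * ∫ y in (0 : ℝ)..x, Real.exp (κ * y) * p y

/-- The anticausal resolvent `(1 - κ⁻¹ ∂)⁻¹`: the bounded solution `y` of `y' = κ (y - p)`. -/
noncomputable def bwd (κ : ℝ) (p : ℝ → ℝ) (x : ℝ) : ℝ :=
  κ * Real.exp (κ * x) * ∫ y in Ioi x, Real.exp (-κ * y) * p y

theorem fwd_zero_right (κ : ℝ) (p : ℝ → ℝ) : fwd κ p 0 = 0 := by simp [fwd]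

theorem bwd_congr {κ : ℝ} {p q : ℝ → ℝ} {x : ℝ} (h : ∀ y, x ≤ y → p y = q y) :
    bwd κ p x = bwd κ q x := by
  unfold bwd
  congr 1
  refine setIntegral_congr_fun measurableSet_Ioi fun y hy => ?_
  simp only [h y (le_of_lt hy)]

theorem hasDerivAt_fwd (κ : ℝ) {p : ℝ → ℝ} (hp : Continuous p) (x : ℝ) :
    HasDerivAt (fwd κ p) (κ * (p x - fwd κ p x)) x := by
  have hc : Continuous fun y => Real.exp (κ * y) * p y := by fun_prop
  have h1 : HasDerivAt (fun x => ∫ y in (0 : ℝ)..x, Real.exp (κ * y) * p y)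
      (Real.exp (κ * x) * p x) x := hc.integral_hasStrictDerivAt 0 x |>.hasDerivAt
  have h2 : HasDerivAt (fun x => κ * Real.exp (-κ * x)) (κ * (Real.exp (-κ * x) * (-κ * 1))) x :=
    (((hasDerivAt_id x).const_mul (-κ)).exp).const_mul κ
  refine (h2.mul h1).congr_deriv ?_
  have h3 : Real.exp (-κ * x) * Real.exp (κ * x) = 1 := by rw [← Real.exp_add]; simp
  unfold fwd
  linear_combination (κ * p x) * h3

theorem bwd_eq {κ : ℝ} {p : ℝ → ℝ} (a : ℝ)
    (hi : ∀ b, IntegrableOn (fun y => Real.exp (-κ * y) * p y) (Ioi b)) (x : ℝ) :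
    bwd κ p x = κ * Real.exp (κ * x) * ((∫ y in Ioi a, Real.exp (-κ * y) * p y)
      - ∫ y in a..x, Real.exp (-κ * y) * p y) := by
  rw [bwd, ← intervalIntegral.integral_Ioi_sub_Ioi' (hi a) (hi x)]
  ring

theorem integrableOn_Ioi_of_continuous {f : ℝ → ℝ} {a : ℝ} (hf : Continuous f)
    (h : IntegrableOn f (Ioi a)) (b : ℝ) : IntegrableOn f (Ioi b) := by
  have : IntegrableOn f (Icc b a ∪ Ioi a) := (hf.continuousOn.integrableOn_Icc).union h
  refine this.mono_set fun y hy => ?_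
  rcases le_or_gt y a with h | h
  · exact Or.inl ⟨le_of_lt hy, h⟩
  · exact Or.inr h

theorem hasDerivAt_bwd {κ C a : ℝ} (hκ : 0 < κ) {p : ℝ → ℝ} (hp : Continuous p)
    (hC : ∀ y, a ≤ y → |p y| ≤ C) (x : ℝ) :
    HasDerivAt (bwd κ p) (κ * (bwd κ p x - p x)) x := by
  have hc : Continuous fun y => Real.exp (-κ * y) * p y := by fun_prop
  have hi := integrableOn_Ioi_of_continuous hc (integrableOn_exp_mul_of_bounded hκ hp hC)
  have h1 : HasDerivAt (fun x => ∫ y in (0 : ℝ)..x, Real.exp (-κ * y) * p y)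
      (Real.exp (-κ * x) * p x) x := hc.integral_hasStrictDerivAt 0 x |>.hasDerivAt
  have h2 : HasDerivAt (fun x => κ * Real.exp (κ * x)) (κ * (Real.exp (κ * x) * (κ * 1))) x :=
    (((hasDerivAt_id x).const_mul κ).exp).const_mul κ
  have h4 : bwd κ p = fun x => κ * Real.exp (κ * x) * ((∫ y in Ioi 0, Real.exp (-κ * y) * p y)
      - ∫ y in (0:ℝ)..x, Real.exp (-κ * y) * p y) := funext fun x => bwd_eq 0 hi x
  rw [h4]
  refine (h2.mul (h1.const_sub _)).congr_deriv ?_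
  have h3 : Real.exp (κ * x) * Real.exp (-κ * x) = 1 := by rw [← Real.exp_add]; simp
  linear_combination (-κ * p x) * h3

theorem continuous_fwd (κ : ℝ) {p : ℝ → ℝ} (hp : Continuous p) : Continuous (fwd κ p) :=
  continuous_iff_continuousAt.2 fun x => (hasDerivAt_fwd κ hp x).continuousAt

theorem continuous_bwd {κ C a : ℝ} (hκ : 0 < κ) {p : ℝ → ℝ} (hp : Continuous p)
    (hC : ∀ y, a ≤ y → |p y| ≤ C) : Continuous (bwd κ p) :=
  continuous_iff_continuousAt.2 fun x => (hasDerivAt_bwd hκ hp hC x).continuousAt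

theorem abs_fwd_le_fwd_abs {κ : ℝ} (hκ : 0 < κ) (p : ℝ → ℝ) {x : ℝ} (hx : 0 ≤ x) :
    |fwd κ p x| ≤ fwd κ (fun y => |p y|) x := by
  unfold fwd
  rw [abs_mul, abs_of_pos (by positivity : 0 < κ * Real.exp (-κ * x))]
  gcongr
  refine (intervalIntegral.abs_integral_le_integral_abs hx).trans_eq ?_
  simp only [abs_mul, Real.abs_exp]

theorem abs_bwd_le_bwd_abs {κ : ℝ} (hκ : 0 < κ) (p : ℝ → ℝ) (x : ℝ) :
    |bwd κ p x| ≤ bwd κ (fun y => |p y|) x := by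
  unfold bwd
  rw [abs_mul, abs_of_pos (by positivity : 0 < κ * Real.exp (κ * x))]
  gcongr
  refine (abs_integral_le_integral_abs).trans_eq ?_
  simp only [abs_mul, Real.abs_exp]

theorem abs_bwd_le {κ C x : ℝ} (hκ : 0 < κ) {p : ℝ → ℝ} (hC : ∀ y, x ≤ y → |p y| ≤ C) :
    |bwd κ p x| ≤ C := by
  unfold bwd
  rw [abs_mul, abs_of_pos (by positivity : 0 < κ * Real.exp (κ * x))]
  refine (mul_le_mul_of_nonneg_left (abs_integral_exp_mul_le hκ hC) (by positivity)).trans_eq ?_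
  have h3 : Real.exp (κ * x) * Real.exp (-κ * x) = 1 := by rw [← Real.exp_add]; simp
  rw [neg_mul] at h3
  field_simp
  linear_combination C * h3

theorem abs_fwd_le {κ C x : ℝ} (hκ : 0 < κ) (hx : 0 ≤ x) {p : ℝ → ℝ}
    (hC : ∀ y, 0 ≤ y → y ≤ x → |p y| ≤ C) : |fwd κ p x| ≤ C := by
  have hC0 : 0 ≤ C := (abs_nonneg _).trans (hC 0 le_rfl hx)
  have h1 : ∫ y in (0 : ℝ)..x, Real.exp (κ * y) = (Real.exp (κ * x) - 1) / κ := by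
    rw [intervalIntegral.integral_comp_mul_left (fun y => Real.exp y) hκ.ne', integral_exp]
    simp; field_simp
  have h2 : |∫ y in (0 : ℝ)..x, Real.exp (κ * y) * p y| ≤ (Real.exp (κ * x) - 1) / κ * C := by
    rw [← h1, ← intervalIntegral.integral_mul_const, ← Real.norm_eq_abs]
    refine intervalIntegral.norm_integral_le_of_norm_le hx (Eventually.of_forall fun y hy => ?_)
      (Continuous.intervalIntegrable (by fun_prop) _ _)
    rw [Real.norm_eq_abs, abs_mul, Real.abs_exp]
    exact mul_le_mul_of_nonneg_left (hC y hy.1.le hy.2) (Real.exp_pos _).le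
  unfold fwd
  rw [abs_mul, abs_of_pos (by positivity : 0 < κ * Real.exp (-κ * x))]
  have h3 : Real.exp (-κ * x) * Real.exp (κ * x) = 1 := by rw [← Real.exp_add]; simp
  have h4 := mul_le_mul_of_nonneg_left h2 (by positivity : 0 ≤ κ * Real.exp (-κ * x))
  refine h4.trans ?_
  have h5 : κ * Real.exp (-κ * x) * ((Real.exp (κ * x) - 1) / κ * C)
      = C - C * Real.exp (-κ * x) := by
    rw [neg_mul] at h3
    field_simp
    linear_combination C * h3
  rw [h5]
  nlinarith [Real.exp_pos (-κ * x)]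

theorem fwd_nonneg {κ : ℝ} (hκ : 0 < κ) {p : ℝ → ℝ} (hp : ∀ y, 0 ≤ p y) {x : ℝ} (hx : 0 ≤ x) :
    0 ≤ fwd κ p x := by
  unfold fwd
  have := intervalIntegral.integral_nonneg (μ := volume) hx
    (fun y _ => mul_nonneg (Real.exp_pos (κ * y)).le (hp y))
  positivity

theorem bwd_nonneg {κ : ℝ} (hκ : 0 < κ) {p : ℝ → ℝ} (hp : ∀ y, 0 ≤ p y) (x : ℝ) :
    0 ≤ bwd κ p x := by
  unfold bwd
  have : 0 ≤ ∫ y in Ioi x, Real.exp (-κ * y) * p y :=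
    integral_nonneg fun y => mul_nonneg (Real.exp_pos _).le (hp y)
  positivity

/-- Integrating `y' = κ (p - y)` shows that the causal resolvent does not increase mass. -/
theorem integral_fwd_le {κ : ℝ} (hκ : 0 < κ) {p : ℝ → ℝ} (hp : Continuous p) (h0 : ∀ y, 0 ≤ p y)
    {X : ℝ} (hX : 0 ≤ X) : ∫ x in (0 : ℝ)..X, fwd κ p x ≤ ∫ x in (0 : ℝ)..X, p x := by
  have h := intervalIntegral.integral_eq_sub_of_hasDerivAt (a := 0) (b := X)
    (fun x _ => hasDerivAt_fwd κ hp x)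
    (((hp.sub (continuous_fwd κ hp)).const_smul κ).intervalIntegrable _ _)
  rw [intervalIntegral.integral_const_mul, intervalIntegral.integral_sub
    (hp.intervalIntegrable _ _) ((continuous_fwd κ hp).intervalIntegrable _ _),
    fwd_zero_right, sub_zero] at h
  have := fwd_nonneg hκ h0 hX
  rw [← h] at this
  have := nonneg_of_mul_nonneg_right this hκ
  linarith

/-- Integrating `y' = κ (y - p)` bounds the mass of the anticausal resolvent on `[0, X]`; mass
coming from `(X, ∞)` contributes at most the boundary term `M / κ`, uniformly in `X`. -/
theorem integral_bwd_le {κ M : ℝ} (hκ : 0 < κ) {p : ℝ → ℝ} (hp : Continuous p)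
    (h0 : ∀ y, 0 ≤ p y) (hM : ∀ y, 0 ≤ y → |p y| ≤ M) {X : ℝ} (hX : 0 ≤ X) :
    ∫ x in (0 : ℝ)..X, bwd κ p x ≤ (∫ x in (0 : ℝ)..X, p x) + M / κ := by
  have hb := continuous_bwd hκ hp hM
  have h := intervalIntegral.integral_eq_sub_of_hasDerivAt (a := 0) (b := X)
    (fun x _ => hasDerivAt_bwd hκ hp hM x)
    (((hb.sub hp).const_smul κ).intervalIntegrable _ _)
  rw [intervalIntegral.integral_const_mul, intervalIntegral.integral_sub
    (hb.intervalIntegrable _ _) (hp.intervalIntegrable _ _)] at h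
  have h1 := bwd_nonneg hκ h0 0
  have h2 := (le_abs_self _).trans (abs_bwd_le hκ (fun y hy => hM y (hX.trans hy)))
  have h3 : (∫ x in (0 : ℝ)..X, bwd κ p x) - (∫ x in (0 : ℝ)..X, p x) ≤ M / κ := by
    rw [le_div_iff₀ hκ]; linarith
  linarith

/-- The Laplace transform of a derivative. -/
theorem integral_exp_mul_deriv {s C C' : ℝ} (hs : 0 < s) {p p' : ℝ → ℝ}
    (hp : ∀ x, HasDerivAt p (p' x) x) (hp' : Continuous p') (hC : ∀ y, 0 ≤ y → |p y| ≤ C)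
    (hC' : ∀ y, 0 ≤ y → |p' y| ≤ C') :
    ∫ x in Ioi 0, Real.exp (-s * x) * p' x = s * (∫ x in Ioi 0, Real.exp (-s * x) * p x) - p 0 := by
  have hpc : Continuous p := continuous_iff_continuousAt.2 fun x => (hp x).continuousAt
  have i1 := integrableOn_exp_mul_of_bounded hs hpc hC
  have i2 := integrableOn_exp_mul_of_bounded hs hp' hC'
  have hd : ∀ x ∈ Ici (0 : ℝ), HasDerivAt (fun x => Real.exp (-s * x) * p x)
      (Real.exp (-s * x) * p' x - s * (Real.exp (-s * x) * p x)) x := fun x _ => by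
    refine ((((hasDerivAt_id x).const_mul (-s)).exp).mul (hp x)).congr_deriv ?_
    simp only [id]; ring
  have ht : Tendsto (fun x => Real.exp (-s * x) * p x) atTop (𝓝 0) := by
    have h1 : Tendsto (fun x => Real.exp (-s * x) * C) atTop (𝓝 (0 * C)) := by
      refine Tendsto.mul_const _ (Real.tendsto_exp_atBot.comp ?_)
      exact tendsto_id.const_mul_atTop_of_neg (neg_lt_zero.2 hs)
    rw [zero_mul] at h1
    refine squeeze_zero_norm' ?_ h1
    filter_upwards [eventually_ge_atTop 0] with x hx
    rw [Real.norm_eq_abs, abs_mul, Real.abs_exp]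
    exact mul_le_mul_of_nonneg_left (hC x hx) (Real.exp_pos _).le
  have h := integral_Ioi_of_hasDerivAt_of_tendsto' hd (i2.sub (i1.const_mul s)) ht
  rw [integral_sub i2 (i1.const_mul s), integral_const_mul, sub_eq_iff_eq_add] at h
  rw [h]
  simp only [mul_zero, Real.exp_zero, one_mul]
  ring

/-! ### Scalar decay lemmas -/

/-- Barbalat's lemma: a Lipschitz function that is square integrable on `[0, ∞)` tends to `0`. -/
theorem tendsto_zero_of_lipschitz_of_integral_sq_le {f : ℝ → ℝ} {K C : ℝ} (hf : Continuous f)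
    (hL : ∀ x y, 0 < x → 0 < y → |f x - f y| ≤ K * |x - y|)
    (hC : ∀ T, 0 ≤ T → ∫ x in (0 : ℝ)..T, f x ^ 2 ≤ C) : Tendsto f atTop (𝓝 0) := by
  have hK : 0 ≤ K := by
    have := (abs_nonneg _).trans (hL 2 1 (by norm_num) one_pos)
    norm_num at this
    exact this
  have hi : ∀ a b, IntervalIntegrable (fun x => f x ^ 2) volume a b :=
    fun a b => (hf.pow 2).intervalIntegrable a b
  set J : ℝ → ℝ := fun T => ∫ x in (0 : ℝ)..T, f x ^ 2 with hJ
  have hJd : ∀ a b, J b - J a = ∫ x in a..b, f x ^ 2 := fun a b =>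
    intervalIntegral.integral_interval_sub_left (hi _ _) (hi _ _)
  have hmono : Monotone J := fun a b hab => by
    have := intervalIntegral.integral_nonneg (μ := volume) hab (fun x _ => sq_nonneg (f x))
    rw [← hJd] at this
    linarith
  have hbdd : BddAbove (range J) := ⟨C, by
    rintro _ ⟨T, rfl⟩
    exact (hmono (le_max_left T 0)).trans (hC _ (le_max_right _ _))⟩
  have hlim := tendsto_atTop_ciSup hmono hbdd
  rw [Metric.tendsto_atTop]
  intro ε hε
  -- On an interval of length `δ` the function varies by at most `K δ ≤ ε / 2`.
  set δ := ε / (2 * (K + 1)) with hδ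
  have hδ0 : 0 < δ := by positivity
  have hKδ : K * δ ≤ ε / 2 := by
    have : (K + 1) * δ = ε / 2 := by rw [hδ]; field_simp
    nlinarith
  have hdiff : Tendsto (fun t => J (t + δ) - J t) atTop (𝓝 0) := by
    have := (hlim.comp (tendsto_atTop_add_const_right atTop δ tendsto_id)).sub hlim
    simpa using this
  have hev := hdiff.eventually (gt_mem_nhds (show (0 : ℝ) < δ * (ε / 2) ^ 2 by positivity))
  obtain ⟨N, hN⟩ := eventually_atTop.1 (hev.and (eventually_gt_atTop 0))
  refine ⟨N, fun t ht => ?_⟩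
  obtain ⟨h1, h0⟩ := hN t ht
  rw [Real.dist_eq, sub_zero]
  by_contra! hcon
  have hlow : ∫ x in t..(t + δ), (ε / 2) ^ 2 ≤ ∫ x in t..(t + δ), f x ^ 2 := by
    refine intervalIntegral.integral_mono_on (by linarith) (by simp) (hi _ _) fun x hx => ?_
    have h2 := hL t x h0 (h0.trans_le hx.1)
    have h3 : |t - x| ≤ δ := by rw [abs_le]; constructor <;> linarith [hx.1, hx.2]
    have h4 : |f t| - |f x| ≤ |f t - f x| := abs_sub_abs_le_abs_sub _ _
    have h5 : ε / 2 ≤ |f x| := by nlinarith [mul_le_mul_of_nonneg_left h3 hK]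
    rw [← sq_abs (f x)]
    exact pow_le_pow_left₀ (by positivity) h5 2
  rw [← hJd, intervalIntegral.integral_const, smul_eq_mul, add_sub_cancel_left] at hlow
  linarith

/-- A bounded solution of `y' = l y + m`, with `l ≠ 0` and `m → 0`, is eventually at most `ε`. For
`l < 0` the equation is stable; for `l > 0` every solution not tending to `0` is unbounded. -/
theorem eventually_le_of_linear_ode {y m : ℝ → ℝ} {l C : ℝ} (hl : l ≠ 0)
    (hy : ∀ t, 0 < t → HasDerivAt y (l * y t + m t) t) (hC : ∀ t, 0 < t → |y t| ≤ C)
    (hm : Tendsto m atTop (𝓝 0)) {ε : ℝ} (hε : 0 < ε) : ∀ᶠ t in atTop, y t ≤ ε := by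
  have hlε : 0 < |l| * (ε / 2) := by positivity
  have hmb : ∀ᶠ t in atTop, |m t| < |l| * (ε / 2) := by
    have := hm.abs
    rw [abs_zero] at this
    exact this.eventually (gt_mem_nhds hlε)
  obtain ⟨T, hT⟩ := eventually_atTop.1 (hmb.and (eventually_gt_atTop 0))
  have hT0 := (hT T le_rfl).2
  -- `b` is monotone or antitone on `[T, ∞)`, according to the sign of `l`.
  set b : ℝ → ℝ := fun t => (y t - ε / 2) * Real.exp (-l * t) with hb
  have hbd : ∀ t, T ≤ t → HasDerivAt b ((l * (ε / 2) + m t) * Real.exp (-l * t)) t := by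
    intro t ht
    refine (((hy t (hT0.trans_le ht)).sub_const (ε / 2)).mul
      (((hasDerivAt_id t).const_mul (-l)).exp)).congr_deriv ?_
    simp only [id]; ring
  have hbc : ContinuousOn b (Ici T) := fun t ht => (hbd t ht).continuousAt.continuousWithinAt
  have hdiff : DifferentiableOn ℝ b (interior (Ici T)) := fun t ht =>
    (hbd t (interior_subset ht)).differentiableAt.differentiableWithinAt
  rcases lt_or_gt_of_ne hl with hneg | hpos
  · have hanti : AntitoneOn b (Ici T) := by
      refine antitoneOn_of_deriv_nonpos (convex_Ici T) hbc hdiff fun t ht => ?_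
      have ht' : T ≤ t := interior_subset ht
      rw [(hbd t ht').deriv]
      have h1 := (hT t ht').1
      rw [abs_of_neg hneg] at h1
      exact mul_nonpos_of_nonpos_of_nonneg (by linarith [le_abs_self (m t)]) (Real.exp_pos _).le
    have hdec : Tendsto (fun t => |b T| * Real.exp (l * t)) atTop (𝓝 (|b T| * 0)) :=
      (Real.tendsto_exp_atBot.comp (tendsto_id.const_mul_atTop_of_neg hneg)).const_mul _
    rw [mul_zero] at hdec
    filter_upwards [eventually_ge_atTop T, hdec.eventually (gt_mem_nhds (half_pos hε))] with t ht h2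
    have h3 : b t ≤ |b T| := (hanti self_mem_Ici ht ht).trans (le_abs_self _)
    have h4 : b t * Real.exp (l * t) = y t - ε / 2 := by
      rw [hb]; simp only; rw [mul_assoc, ← Real.exp_add]; simp
    have := mul_le_mul_of_nonneg_right h3 (Real.exp_pos (l * t)).le
    linarith
  · have hmon : MonotoneOn b (Ici T) := by
      refine monotoneOn_of_deriv_nonneg (convex_Ici T) hbc hdiff fun t ht => ?_
      have ht' : T ≤ t := interior_subset ht
      rw [(hbd t ht').deriv]
      have h1 := (hT t ht').1
      rw [abs_of_pos hpos] at h1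
      exact mul_nonneg (by linarith [neg_abs_le (m t)]) (Real.exp_pos _).le
    have hb0 : Tendsto b atTop (𝓝 0) := by
      have h1 : Tendsto (fun t => (C + ε / 2) * Real.exp (-l * t)) atTop (𝓝 ((C + ε / 2) * 0)) :=
        (Real.tendsto_exp_atBot.comp
          (tendsto_id.const_mul_atTop_of_neg (neg_lt_zero.2 hpos))).const_mul _
      rw [mul_zero] at h1
      refine squeeze_zero_norm' ?_ h1
      filter_upwards [eventually_ge_atTop T] with t ht
      rw [Real.norm_eq_abs, abs_mul, Real.abs_exp]
      have h2 := hC t (hT0.trans_le ht)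
      have h3 : |y t - ε / 2| ≤ C + ε / 2 := by
        rw [abs_le] at h2 ⊢; constructor <;> linarith [h2.1, h2.2]
      exact mul_le_mul_of_nonneg_right h3 (Real.exp_pos _).le
    filter_upwards [eventually_ge_atTop T] with t ht
    have h1 : b t ≤ 0 := by
      refine ge_of_tendsto hb0 ?_
      filter_upwards [eventually_ge_atTop t] with s hs
      exact hmon ht (ht.trans hs) hs
    have h2 : y t - ε / 2 ≤ 0 := nonpos_of_mul_nonpos_left h1 (Real.exp_pos _)
    linarith

theorem tendsto_zero_of_linear_ode {y m : ℝ → ℝ} {l C : ℝ} (hl : l ≠ 0)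
    (hy : ∀ t, 0 < t → HasDerivAt y (l * y t + m t) t) (hC : ∀ t, 0 < t → |y t| ≤ C)
    (hm : Tendsto m atTop (𝓝 0)) : Tendsto y atTop (𝓝 0) := by
  rw [Metric.tendsto_nhds]
  intro ε hε
  have h2 : ∀ t, 0 < t → HasDerivAt (fun t => -y t) (l * -y t + -m t) t := fun t ht =>
    (hy t ht).neg.congr_deriv (by ring)
  have hm' : Tendsto (fun t => -m t) atTop (𝓝 0) := by simpa using hm.neg
  filter_upwards [eventually_le_of_linear_ode hl hy hC hm (half_pos hε),
    eventually_le_of_linear_ode hl h2 (fun t ht => by rw [abs_neg]; exact hC t ht) hm'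
      (half_pos hε)] with t h3 h4
  rw [Real.dist_eq, sub_zero, abs_lt]
  constructor <;> linarith

/-- If the exponential moments of order `nκ`, `n ≥ 2`, of a uniformly bounded family decay, so does
every weighted integral `∫ e^{-2κx} b(e^{-κx}) w(x, t) dx` with `b` continuous, by Weierstrass'
approximation theorem in the variable `e^{-κx}`. -/
theorem tendsto_integral_of_tendsto_exp_moments {κ M : ℝ} (hκ : 0 < κ) {w : ℝ → ℝ → ℝ}
    (hw : ∀ t, Continuous fun x => w x t) (hM : ∀ t, 0 ≤ t → ∀ x, 0 ≤ x → |w x t| ≤ M)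
    (hmom : ∀ n : ℕ, 2 ≤ n →
      Tendsto (fun t => ∫ x in Ioi 0, Real.exp (-(n * κ) * x) * w x t) atTop (𝓝 0))
    {b : ℝ → ℝ} (hb : Continuous b) :
    Tendsto (fun t => ∫ x in Ioi 0, Real.exp (-(2 * κ) * x) * (b (Real.exp (-κ * x)) * w x t))
      atTop (𝓝 0) := by
  have hM0 : 0 ≤ M := (abs_nonneg _).trans (hM 0 le_rfl 0 le_rfl)
  rw [Metric.tendsto_nhds]
  intro ε hε
  set η := ε * κ / (M + 1) with hη
  have hη0 : 0 < η := by positivity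
  obtain ⟨P, hP⟩ := exists_polynomial_near_of_continuousOn 0 1 b hb.continuousOn η hη0
  have hexp : ∀ (n : ℕ) (x : ℝ), Real.exp (-(2 * κ) * x) * Real.exp (-κ * x) ^ n
      = Real.exp (-((n + 2 : ℕ) * κ) * x) := fun n x => by
    rw [← Real.exp_nat_mul, ← Real.exp_add]; congr 1; push_cast; ring
  have hint : ∀ t, 0 ≤ t → ∀ n : ℕ,
      IntegrableOn (fun x => Real.exp (-((n + 2 : ℕ) * κ) * x) * w x t) (Ioi 0) := fun t ht n =>
    integrableOn_exp_mul_of_bounded (by positivity) (hw t) (hM t ht)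
  have hPint : ∀ t, 0 ≤ t →
      ∫ x in Ioi 0, Real.exp (-(2 * κ) * x) * (P.eval (Real.exp (-κ * x)) * w x t)
      = ∑ i ∈ Finset.range (P.natDegree + 1),
        P.coeff i * ∫ x in Ioi 0, Real.exp (-((i + 2 : ℕ) * κ) * x) * w x t := fun t ht => by
    simp_rw [← integral_const_mul]
    rw [← integral_finsetSum _ fun i _ => (hint t ht i).const_mul _]
    refine integral_congr_ae (Eventually.of_forall fun x => ?_)
    simp only [Polynomial.eval_eq_sum_range, Finset.sum_mul, Finset.mul_sum, ← hexp]
    exact Finset.sum_congr rfl fun i _ => by ring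
  have hPlim : Tendsto (fun t => ∑ i ∈ Finset.range (P.natDegree + 1),
        P.coeff i * ∫ x in Ioi 0, Real.exp (-((i + 2 : ℕ) * κ) * x) * w x t) atTop (𝓝 0) := by
    have := tendsto_finsetSum (Finset.range (P.natDegree + 1))
      (fun i _ => (hmom (i + 2) (by omega)).const_mul (P.coeff i))
    simpa using this
  filter_upwards [eventually_ge_atTop 0,
    hPlim.abs.eventually (gt_mem_nhds (show |(0 : ℝ)| < ε / 2 by simpa using hε))] with t ht hsmall
  rw [← hPint t ht] at hsmall
  have i1 : IntegrableOn (fun x => Real.exp (-(2 * κ) * x) * (P.eval (Real.exp (-κ * x)) * w x t))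
      (Ioi 0) := by
    have : (fun x => Real.exp (-(2 * κ) * x) * (P.eval (Real.exp (-κ * x)) * w x t)) = fun x =>
        ∑ i ∈ Finset.range (P.natDegree + 1),
          P.coeff i * (Real.exp (-((i + 2 : ℕ) * κ) * x) * w x t) := by
      funext x
      simp only [Polynomial.eval_eq_sum_range, Finset.sum_mul, Finset.mul_sum, ← hexp]
      exact Finset.sum_congr rfl fun i _ => by ring
    rw [this]
    exact integrable_finsetSum _ fun i _ => (hint t ht i).const_mul _
  have hclose : ∀ x, 0 ≤ x →
      |P.eval (Real.exp (-κ * x)) * w x t - b (Real.exp (-κ * x)) * w x t| ≤ η * M := by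
    intro x hx
    rw [← sub_mul, abs_mul]
    have h1 : Real.exp (-κ * x) ∈ Icc (0 : ℝ) 1 :=
      ⟨(Real.exp_pos _).le, Real.exp_le_one_iff.2 (by nlinarith)⟩
    exact mul_le_mul (hP _ h1).le (hM t ht x hx) (abs_nonneg _) hη0.le
  have hwt := hw t
  have i2 : IntegrableOn (fun x => Real.exp (-(2 * κ) * x) *
      (P.eval (Real.exp (-κ * x)) * w x t - b (Real.exp (-κ * x)) * w x t)) (Ioi 0) :=
    integrableOn_exp_mul_of_bounded (by positivity)
      (by have := P.continuous; fun_prop) hclose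
  have h3 := abs_integral_exp_mul_le (s := 2 * κ) (a := 0) (by positivity) hclose
  have h4 : ∫ x in Ioi 0, Real.exp (-(2 * κ) * x) * (b (Real.exp (-κ * x)) * w x t)
      = (∫ x in Ioi 0, Real.exp (-(2 * κ) * x) * (P.eval (Real.exp (-κ * x)) * w x t))
        - ∫ x in Ioi 0, Real.exp (-(2 * κ) * x) *
          (P.eval (Real.exp (-κ * x)) * w x t - b (Real.exp (-κ * x)) * w x t) := by
    rw [← integral_sub i1 i2]
    refine integral_congr_ae (Eventually.of_forall fun x => ?_)
    simp only; ring
  rw [Real.dist_eq, sub_zero, h4]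
  refine (abs_sub _ _).trans_lt ?_
  have h5 : Real.exp (-(2 * κ) * 0) / (2 * κ) * (η * M) < ε / 2 := by
    rw [mul_zero, Real.exp_zero, hη]
    have : 1 / (2 * κ) * (ε * κ / (M + 1) * M) = ε / 2 * (M / (M + 1)) := by field_simp
    rw [this]
    have : M / (M + 1) < 1 := by rw [div_lt_one (by positivity)]; linarith
    nlinarith
  linarith

/-- Exponential moments detect pointwise decay of an equicontinuous bounded family. -/
theorem tendsto_zero_of_tendsto_exp_moments {κ M : ℝ} (hκ : 0 < κ) {w : ℝ → ℝ → ℝ}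
    (hw : ∀ t, Continuous fun x => w x t) (hM : ∀ t, 0 ≤ t → ∀ x, 0 ≤ x → |w x t| ≤ M)
    (hmom : ∀ n : ℕ, 2 ≤ n →
      Tendsto (fun t => ∫ x in Ioi 0, Real.exp (-(n * κ) * x) * w x t) atTop (𝓝 0))
    {x₀ : ℝ} (hx₀ : 0 < x₀) (hequi : ∀ ε, 0 < ε → ∃ δ, 0 < δ ∧ ∀ t, 0 ≤ t → ∀ x, 0 ≤ x →
      |x - x₀| ≤ δ → |w x t - w x₀ t| ≤ ε) :
    Tendsto (fun t => w x₀ t) atTop (𝓝 0) := by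
  rw [Metric.tendsto_nhds]
  intro ε hε
  obtain ⟨δ, hδ, hequi⟩ := hequi (ε / 2) (half_pos hε)
  -- A tent in the variable `ξ = e^{-κx}`, supported where `|x - x₀| ≤ δ`.
  obtain ⟨η, hη, hloc⟩ : ∃ η : ℝ, 0 < η ∧ ∀ x, |Real.exp (-κ * x) - Real.exp (-κ * x₀)| < η →
      |x - x₀| ≤ δ := by
    have hcont : ContinuousAt (fun ξ => Real.log ξ / (-κ)) (Real.exp (-κ * x₀)) :=
      (Real.continuousAt_log (Real.exp_pos _).ne').div_const _
    obtain ⟨η, hη, h⟩ := Metric.continuousAt_iff.1 hcont δ hδ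
    refine ⟨η, hη, fun x hx => ?_⟩
    have h1 := h (x := Real.exp (-κ * x)) (by rwa [Real.dist_eq])
    simp only [Real.log_exp, Real.dist_eq] at h1
    rw [mul_div_cancel_left₀ _ (neg_ne_zero.2 hκ.ne'),
      mul_div_cancel_left₀ _ (neg_ne_zero.2 hκ.ne')] at h1
    exact h1.le
  set b : ℝ → ℝ := fun ξ => max 0 (η - |ξ - Real.exp (-κ * x₀)|) with hbdef
  have hb : Continuous b := by rw [hbdef]; fun_prop
  have hb0 : ∀ ξ, 0 ≤ b ξ := fun ξ => le_max_left _ _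
  have hbη : ∀ ξ, |b ξ| ≤ η := fun ξ => by
    rw [abs_of_nonneg (hb0 ξ)]
    exact max_le hη.le (by linarith [abs_nonneg (ξ - Real.exp (-κ * x₀))])
  have hbc : Continuous fun x => b (Real.exp (-κ * x)) := by fun_prop
  have iB : IntegrableOn (fun x => Real.exp (-(2 * κ) * x) * b (Real.exp (-κ * x))) (Ioi 0) :=
    integrableOn_exp_mul_of_bounded (by positivity) hbc fun x _ => hbη _
  set B := ∫ x in Ioi 0, Real.exp (-(2 * κ) * x) * b (Real.exp (-κ * x)) with hB
  have hBpos : 0 < B := by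
    rw [hB, setIntegral_pos_iff_support_of_nonneg_ae
      (Eventually.of_forall fun x => mul_nonneg (Real.exp_pos _).le (hb0 _)) iB]
    refine (((Continuous.isOpen_support (by fun_prop)).inter isOpen_Ioi)).measure_pos _
      ⟨x₀, ?_, hx₀⟩
    have h1 : b (Real.exp (-κ * x₀)) = η := by simp [hbdef, hη.le]
    rw [Function.mem_support, h1]
    positivity
  have hlim := tendsto_integral_of_tendsto_exp_moments hκ hw hM hmom hb
  filter_upwards [eventually_ge_atTop 0,
    hlim.abs.eventually (gt_mem_nhds (show |(0 : ℝ)| < ε / 2 * B by rw [abs_zero]; positivity))]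
    with t ht hsmall
  have hwt := hw t
  have i1 : IntegrableOn (fun x => Real.exp (-(2 * κ) * x) * (b (Real.exp (-κ * x)) * w x t))
      (Ioi 0) := by
    refine integrableOn_exp_mul_of_bounded (C := η * M) (by positivity) (by fun_prop) fun x hx => ?_
    rw [abs_mul]
    exact mul_le_mul (hbη _) (hM t ht x hx) (abs_nonneg _) hη.le
  have h1 : |w x₀ t * B - ∫ x in Ioi 0, Real.exp (-(2 * κ) * x) * (b (Real.exp (-κ * x)) * w x t)|
      ≤ ε / 2 * B := by
    rw [hB, ← integral_const_mul, ← integral_const_mul, ← integral_sub (iB.const_mul _) i1,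
      ← Real.norm_eq_abs]
    refine norm_integral_le_of_norm_le (iB.const_mul _) ?_
    refine (ae_restrict_mem measurableSet_Ioi).mono fun x hx => ?_
    have h2 : w x₀ t * (Real.exp (-(2 * κ) * x) * b (Real.exp (-κ * x)))
        - Real.exp (-(2 * κ) * x) * (b (Real.exp (-κ * x)) * w x t)
        = (w x₀ t - w x t) * (Real.exp (-(2 * κ) * x) * b (Real.exp (-κ * x))) := by ring
    rw [h2, Real.norm_eq_abs, abs_mul, abs_of_nonneg (mul_nonneg (Real.exp_pos _).le (hb0 _))]
    by_cases hx' : |Real.exp (-κ * x) - Real.exp (-κ * x₀)| < η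
    · rw [abs_sub_comm]
      exact mul_le_mul_of_nonneg_right (hequi t ht x (le_of_lt hx) (hloc x hx'))
        (mul_nonneg (Real.exp_pos _).le (hb0 _))
    · have : b (Real.exp (-κ * x)) = 0 := max_eq_left (by linarith)
      rw [this, mul_zero, mul_zero, mul_zero]
  have h3 : |w x₀ t| * B < ε * B := by
    rw [← abs_of_pos hBpos, ← abs_mul, abs_of_pos hBpos]
    have := abs_sub_abs_le_abs_sub (w x₀ t * B)
      (∫ x in Ioi 0, Real.exp (-(2 * κ) * x) * (b (Real.exp (-κ * x)) * w x t))
    linarith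
  rw [Real.dist_eq, sub_zero]
  exact lt_of_mul_lt_mul_right h3 hBpos.le

/-! ### Parametric calculus on the quarter plane -/

theorem continuous_slice_left {p : ℝ → ℝ → ℝ} (hp : Continuous fun z : ℝ × ℝ => p z.1 z.2) (t : ℝ) :
    Continuous fun x => p x t :=
  hp.comp (f := fun x : ℝ => (x, t)) (by fun_prop)

theorem continuous_slice_right {p : ℝ → ℝ → ℝ} (hp : Continuous fun z : ℝ × ℝ => p z.1 z.2)
    (x : ℝ) : Continuous fun t => p x t :=
  hp.comp (f := fun t : ℝ => (x, t)) (by fun_prop)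

/-- A function `p = p(x, t)` bounded on `[0, ∞) × (-∞, T]` for every `T`. -/
def BoundedUpToTime (p : ℝ → ℝ → ℝ) : Prop :=
  ∀ T : ℝ, ∃ C : ℝ, ∀ x, 0 ≤ x → ∀ t, t ≤ T → |p x t| ≤ C

theorem BoundedUpToTime.sub {p q : ℝ → ℝ → ℝ} (hp : BoundedUpToTime p) (hq : BoundedUpToTime q) :
    BoundedUpToTime fun x t => p x t - q x t := fun T => by
  obtain ⟨C, hC⟩ := hp T
  obtain ⟨D, hD⟩ := hq T
  exact ⟨C + D, fun x hx t ht => (abs_sub _ _).trans (add_le_add (hC x hx t ht) (hD x hx t ht))⟩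

theorem BoundedUpToTime.fwd {κ : ℝ} (hκ : 0 < κ) {p : ℝ → ℝ → ℝ} (hp : BoundedUpToTime p) :
    BoundedUpToTime fun x t => fwd κ (fun y => p y t) x := fun T => by
  obtain ⟨C, hC⟩ := hp T
  exact ⟨C, fun x hx t ht => abs_fwd_le hκ hx fun y hy _ => hC y hy t ht⟩

theorem BoundedUpToTime.bwd {κ : ℝ} (hκ : 0 < κ) {p : ℝ → ℝ → ℝ} (hp : BoundedUpToTime p) :
    BoundedUpToTime fun x t => bwd κ (fun y => p y t) x := fun T => by
  obtain ⟨C, hC⟩ := hp T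
  exact ⟨C, fun x hx t ht => abs_bwd_le hκ fun y hy => hC y (hx.trans hy) t ht⟩

theorem continuous_fwd_param (κ : ℝ) {p : ℝ → ℝ → ℝ} (hp : Continuous fun z : ℝ × ℝ => p z.1 z.2) :
    Continuous fun z : ℝ × ℝ => fwd κ (fun y => p y z.2) z.1 := by
  unfold fwd
  have h1 : Continuous (Function.uncurry fun (z : ℝ × ℝ) (y : ℝ) => Real.exp (κ * y) * p y z.2) := by
    have := hp.comp (f := fun a : (ℝ × ℝ) × ℝ => (a.2, a.1.2)) (by fun_prop)
    exact (Continuous.rexp (by fun_prop)).mul this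
  have := intervalIntegral.continuous_parametric_intervalIntegral_of_continuous (μ := volume)
    (a₀ := 0) h1 continuous_fst
  exact (by fun_prop : Continuous fun z : ℝ × ℝ => κ * Real.exp (-κ * z.1)).mul this

theorem continuous_integral_exp_mul {s : ℝ} (hs : 0 < s) {p : ℝ → ℝ → ℝ}
    (hp : Continuous fun z : ℝ × ℝ => p z.1 z.2) (hb : BoundedUpToTime p) :
    Continuous fun t => ∫ y in Ioi 0, Real.exp (-s * y) * p y t := by
  refine continuous_iff_continuousAt.2 fun t => ?_
  obtain ⟨C, hC⟩ := hb (t + 1)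
  refine continuousAt_of_dominated (bound := fun y => Real.exp (-s * y) * C) ?_ ?_
    ((integrableOn_exp_neg_mul hs 0).mul_const C) ?_
  · refine Eventually.of_forall fun t => Continuous.aestronglyMeasurable ?_
    have := hp.comp (f := fun y : ℝ => (y, t)) (by fun_prop)
    exact (by fun_prop : Continuous fun y => Real.exp (-s * y)).mul this
  · filter_upwards [Iic_mem_nhds (show t < t + 1 by linarith)] with t' ht'
    refine (ae_restrict_mem measurableSet_Ioi).mono fun y hy => ?_
    rw [Real.norm_eq_abs, abs_mul, Real.abs_exp]
    exact mul_le_mul_of_nonneg_left (hC y (le_of_lt hy) t' ht') (Real.exp_pos _).le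
  · refine Eventually.of_forall fun y => Continuous.continuousAt ?_
    exact continuous_const.mul (continuous_slice_right hp y)

theorem continuous_bwd_param {κ : ℝ} (hκ : 0 < κ) {p : ℝ → ℝ → ℝ}
    (hp : Continuous fun z : ℝ × ℝ => p z.1 z.2) (hb : BoundedUpToTime p) :
    Continuous fun z : ℝ × ℝ => bwd κ (fun y => p y z.2) z.1 := by
  have hpt := continuous_slice_left hp
  have h0 : (fun z : ℝ × ℝ => bwd κ (fun y => p y z.2) z.1) = fun z : ℝ × ℝ =>
      κ * Real.exp (κ * z.1) * ((∫ y in Ioi 0, Real.exp (-κ * y) * p y z.2)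
        - ∫ y in (0 : ℝ)..z.1, Real.exp (-κ * y) * p y z.2) := by
    funext z
    obtain ⟨C, hC⟩ := hb z.2
    have h2 := hpt z.2
    exact bwd_eq 0 (integrableOn_Ioi_of_continuous (by fun_prop)
      (integrableOn_exp_mul_of_bounded hκ h2 fun y hy => hC y hy _ le_rfl)) z.1
  have h1 : Continuous (Function.uncurry
      fun (z : ℝ × ℝ) (y : ℝ) => Real.exp (-κ * y) * p y z.2) := by
    have := hp.comp (f := fun a : (ℝ × ℝ) × ℝ => (a.2, a.1.2)) (by fun_prop)
    exact (Continuous.rexp (by fun_prop)).mul this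
  have h2 := intervalIntegral.continuous_parametric_intervalIntegral_of_continuous (μ := volume)
    (a₀ := 0) h1 continuous_fst
  have h3 := (continuous_integral_exp_mul hκ hp hb).comp (continuous_snd (X := ℝ))
  rw [h0]
  exact (by fun_prop : Continuous fun z : ℝ × ℝ => κ * Real.exp (κ * z.1)).mul (h3.sub h2)

theorem hasDerivAt_integral_exp_mul {s : ℝ} (hs : 0 < s) {p p' : ℝ → ℝ → ℝ}
    (hp : Continuous fun z : ℝ × ℝ => p z.1 z.2) (hb : BoundedUpToTime p)
    (hp' : Continuous fun z : ℝ × ℝ => p' z.1 z.2) (hb' : BoundedUpToTime p') {x t : ℝ} (hx : 0 ≤ x)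
    (ht : 0 < t) (hd : ∀ y, 0 ≤ y → ∀ t, 0 < t → HasDerivAt (fun t => p y t) (p' y t) t) :
    HasDerivAt (fun t => ∫ y in Ioi x, Real.exp (-s * y) * p y t)
      (∫ y in Ioi x, Real.exp (-s * y) * p' y t) t := by
  obtain ⟨C, hC⟩ := hb (t + 1)
  obtain ⟨C', hC'⟩ := hb' (t + 1)
  have hpt := continuous_slice_left hp
  have hpt' := continuous_slice_left hp'
  have hS : Ioo 0 (t + 1) ∈ 𝓝 t := Ioo_mem_nhds ht (by linarith)
  refine (hasDerivAt_integral_of_dominated_loc_of_deriv_le (𝕜 := ℝ)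
    (F := fun t y => Real.exp (-s * y) * p y t) (F' := fun t y => Real.exp (-s * y) * p' y t)
    (bound := fun y => Real.exp (-s * y) * C') hS ?_ ?_ ?_ ?_
    ((integrableOn_exp_neg_mul hs x).mul_const C') ?_).2
  · exact Eventually.of_forall fun t => by
      have := hpt t
      exact Continuous.aestronglyMeasurable (by fun_prop)
  · exact integrableOn_exp_mul_of_bounded hs (hpt t)
      fun y hy => hC y (hx.trans hy) t (by linarith)
  · have := hpt' t
    exact Continuous.aestronglyMeasurable (by fun_prop)
  · refine (ae_restrict_mem measurableSet_Ioi).mono fun y hy t' ht' => ?_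
    rw [Real.norm_eq_abs, abs_mul, Real.abs_exp]
    exact mul_le_mul_of_nonneg_left (hC' y (hx.trans (le_of_lt hy)) t' ht'.2.le) (Real.exp_pos _).le
  · refine (ae_restrict_mem measurableSet_Ioi).mono fun y hy t' ht' => ?_
    exact (hd y (hx.trans (le_of_lt hy)) t' ht'.1).const_mul _

theorem hasDerivAt_fwd_param (κ : ℝ) {p p' : ℝ → ℝ → ℝ}
    (hp : Continuous fun z : ℝ × ℝ => p z.1 z.2)
    (hp' : Continuous fun z : ℝ × ℝ => p' z.1 z.2) (hb' : BoundedUpToTime p') {x t : ℝ} (hx : 0 ≤ x)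
    (ht : 0 < t) (hd : ∀ y, 0 ≤ y → ∀ t, 0 < t → HasDerivAt (fun t => p y t) (p' y t) t) :
    HasDerivAt (fun t => fwd κ (fun y => p y t) x) (fwd κ (fun y => p' y t) x) t := by
  obtain ⟨C', hC'⟩ := hb' (t + 1)
  have hpt := continuous_slice_left hp
  have hpt' := continuous_slice_left hp'
  have hS : Ioo 0 (t + 1) ∈ 𝓝 t := Ioo_mem_nhds ht (by linarith)
  refine ((intervalIntegral.hasDerivAt_integral_of_dominated_loc_of_deriv_le (𝕜 := ℝ)
    (F := fun t y => Real.exp (κ * y) * p y t) (F' := fun t y => Real.exp (κ * y) * p' y t)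
    (bound := fun y => Real.exp (κ * y) * C') hS ?_ ?_ ?_ ?_ ?_ ?_).2).const_mul _
  · exact Eventually.of_forall fun t => by
      have := hpt t
      exact Continuous.aestronglyMeasurable (by fun_prop)
  · have := hpt t
    exact Continuous.intervalIntegrable (by fun_prop) _ _
  · have := hpt' t
    exact Continuous.aestronglyMeasurable (by fun_prop)
  · refine Eventually.of_forall fun y hy t' ht' => ?_
    rw [uIoc_of_le hx] at hy
    rw [Real.norm_eq_abs, abs_mul, Real.abs_exp]
    exact mul_le_mul_of_nonneg_left (hC' y hy.1.le t' ht'.2.le) (Real.exp_pos _).le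
  · exact Continuous.intervalIntegrable (by fun_prop) _ _
  · refine Eventually.of_forall fun y hy t' ht' => ?_
    rw [uIoc_of_le hx] at hy
    exact (hd y hy.1.le t' ht'.1).const_mul _

theorem intervalIntegral_swap_of_continuous {F : ℝ → ℝ → ℝ}
    (hF : Continuous fun z : ℝ × ℝ => F z.1 z.2) (a b c d : ℝ) :
    ∫ x in a..b, ∫ y in c..d, F x y = ∫ y in c..d, ∫ x in a..b, F x y := by
  refine intervalIntegral_intervalIntegral_swap ?_
  refine (hF.continuousOn.integrableOn_compact
    (isCompact_uIcc.prod isCompact_uIcc)).mono_set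
    (prod_mono uIoc_subset_uIcc uIoc_subset_uIcc)

/-- The energy balance of the local conservation law `∂_t (a² / 2) = c ∂_x Φ`. -/
theorem integral_sq_eq_of_conservation_law {a k Φ : ℝ → ℝ → ℝ} {c X T : ℝ} (hX : 0 ≤ X)
    (hT : 0 ≤ T) (ha : Continuous fun z : ℝ × ℝ => a z.1 z.2)
    (hk : Continuous fun z : ℝ × ℝ => k z.1 z.2)
    (hat : ∀ x, 0 ≤ x → ∀ t, 0 < t → HasDerivAt (fun t => a x t) (c * k x t) t)
    (hΦ : ∀ t, 0 ≤ t → ∀ x, HasDerivAt (fun x => Φ x t) (a x t * k x t) x) :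
    ∫ x in (0 : ℝ)..X, a x T ^ 2 =
      (∫ x in (0 : ℝ)..X, a x 0 ^ 2) + 2 * c * ∫ t in (0 : ℝ)..T, (Φ X t - Φ 0 t) := by
  have hax := continuous_slice_right ha
  have hat' := continuous_slice_left ha
  have hkx := continuous_slice_right hk
  have hkt := continuous_slice_left hk
  have h1 : ∀ x ∈ uIcc 0 X, ∫ t in (0 : ℝ)..T, 2 * c * (a x t * k x t) = a x T ^ 2 - a x 0 ^ 2 := by
    intro x hx
    rw [uIcc_of_le hX] at hx
    have hx1 := hax x
    have hx2 := hkx x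
    refine intervalIntegral.integral_eq_sub_of_hasDerivAt_of_le (f := fun t => a x t ^ 2) hT
      (by fun_prop) (fun t ht => ?_) (Continuous.intervalIntegrable (by fun_prop) _ _)
    refine ((hat x hx.1 t ht.1).pow 2).congr_deriv ?_
    simp only [Nat.cast_ofNat]; ring
  have h2 : ∀ t ∈ uIcc 0 T, ∫ x in (0 : ℝ)..X, 2 * c * (a x t * k x t)
      = 2 * c * (Φ X t - Φ 0 t) := by
    intro t ht
    rw [uIcc_of_le hT] at ht
    have ht1 := hat' t
    have ht2 := hkt t
    rw [intervalIntegral.integral_const_mul,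
      intervalIntegral.integral_eq_sub_of_hasDerivAt (fun x _ => hΦ t ht.1 x)
        (Continuous.intervalIntegrable (by fun_prop) _ _)]
  have h3 := intervalIntegral_swap_of_continuous (F := fun x t => 2 * c * (a x t * k x t))
    (continuous_const.mul (ha.mul hk)) 0 X 0 T
  rw [intervalIntegral.integral_congr h1, intervalIntegral.integral_congr h2,
    intervalIntegral.integral_const_mul, intervalIntegral.integral_sub] at h3
  · linarith
  · have := hat' T
    exact Continuous.intervalIntegrable (by fun_prop) _ _
  · have := hat' 0
    exact Continuous.intervalIntegrable (by fun_prop) _ _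

theorem tendsto_bwd_zero {κ : ℝ} (hκ : 0 < κ) {p : ℝ → ℝ} (hp : Tendsto p atTop (𝓝 0)) :
    Tendsto (bwd κ p) atTop (𝓝 0) := by
  rw [Metric.tendsto_atTop] at hp ⊢
  intro ε hε
  obtain ⟨N, hN⟩ := hp (ε / 2) (half_pos hε)
  refine ⟨N, fun x hx => ?_⟩
  rw [Real.dist_eq, sub_zero]
  refine (abs_bwd_le (C := ε / 2) hκ fun y hy => ?_).trans_lt (half_lt_self hε)
  have := hN y (le_trans hx hy)
  rw [Real.dist_eq, sub_zero] at this
  exact this.le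

theorem abs_sub_le_of_hasDerivAt {f f' : ℝ → ℝ} {K : ℝ}
    (hf : ∀ x, 0 < x → HasDerivAt f (f' x) x) (hK : ∀ x, 0 < x → |f' x| ≤ K) {x y : ℝ}
    (hx : 0 < x) (hy : 0 < y) : |f x - f y| ≤ K * |x - y| :=
  (convex_Ioi (0 : ℝ)).norm_image_sub_le_of_norm_hasDerivWithin_le
    (fun z hz => (hf z hz).hasDerivWithinAt) (fun z hz => hK z hz) hy hx

/-! ### Energy identities of the reduced flow -/

theorem fwd_const_mul (κ c : ℝ) (p : ℝ → ℝ) (x : ℝ) :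
    fwd κ (fun y => c * p y) x = c * fwd κ p x := by
  unfold fwd
  simp_rw [mul_left_comm _ c, intervalIntegral.integral_const_mul]
  ring

/-- `w = (1 + κ⁻¹∂)⁻¹ h`, the solution recovered from the reduced unknown `h = w + κ⁻¹ w_x`. -/
noncomputable def flowW (κ : ℝ) (h : ℝ → ℝ → ℝ) (x t : ℝ) : ℝ := fwd κ (fun y => h y t) x

/-- `q = (1 - κ⁻¹∂)⁻¹ w`. -/
noncomputable def flowQ (κ : ℝ) (h : ℝ → ℝ → ℝ) (x t : ℝ) : ℝ := bwd κ (fun y => flowW κ h y t) x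

/-- `v = (1 + κ⁻¹∂)⁻¹ (w - q)`, proportional to the velocity `w_t`. -/
noncomputable def flowV (κ : ℝ) (h : ℝ → ℝ → ℝ) (x t : ℝ) : ℝ :=
  fwd κ (fun y => flowW κ h y t - flowQ κ h y t) x

/-- `h` solves `h_t = c (w - q)` on the quarter plane, where `w = (1 + κ⁻¹∂)⁻¹ h` and
`q = (1 - κ⁻¹∂)⁻¹ w`: the homogeneous linearized BBM equation `w_t + α w_x - κ⁻² w_xxt = 0`,
`w(0, t) = 0`, in terms of `h = w + κ⁻¹ w_x`, with `c = α κ`. -/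
structure IsReducedFlow (κ c : ℝ) (h : ℝ → ℝ → ℝ) : Prop where
  continuous : Continuous fun z : ℝ × ℝ => h z.1 z.2
  bounded : BoundedUpToTime h
  hasDerivAt : ∀ x, 0 ≤ x → ∀ t, 0 < t →
    HasDerivAt (fun t => h x t) (c * (flowW κ h x t - flowQ κ h x t)) t

namespace IsReducedFlow

variable {κ c : ℝ} {h : ℝ → ℝ → ℝ}

theorem boundedW (H : IsReducedFlow κ c h) (hκ : 0 < κ) : BoundedUpToTime (flowW κ h) :=
  H.bounded.fwd hκ

theorem boundedQ (H : IsReducedFlow κ c h) (hκ : 0 < κ) : BoundedUpToTime (flowQ κ h) :=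
  (H.boundedW hκ).bwd hκ

theorem boundedV (H : IsReducedFlow κ c h) (hκ : 0 < κ) : BoundedUpToTime (flowV κ h) :=
  ((H.boundedW hκ).sub (H.boundedQ hκ)).fwd hκ

theorem continuousW (H : IsReducedFlow κ c h) :
    Continuous fun z : ℝ × ℝ => flowW κ h z.1 z.2 :=
  continuous_fwd_param κ H.continuous

theorem continuousQ (H : IsReducedFlow κ c h) (hκ : 0 < κ) :
    Continuous fun z : ℝ × ℝ => flowQ κ h z.1 z.2 :=
  continuous_bwd_param hκ H.continuousW (H.boundedW hκ)

theorem continuousV (H : IsReducedFlow κ c h) (hκ : 0 < κ) :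
    Continuous fun z : ℝ × ℝ => flowV κ h z.1 z.2 :=
  continuous_fwd_param κ (p := fun x t => flowW κ h x t - flowQ κ h x t)
    (H.continuousW.sub (H.continuousQ hκ))

theorem hasDerivAtW (H : IsReducedFlow κ c h) (x t : ℝ) :
    HasDerivAt (fun x => flowW κ h x t) (κ * (h x t - flowW κ h x t)) x :=
  hasDerivAt_fwd κ (continuous_slice_left H.continuous t) x

theorem hasDerivAtQ (H : IsReducedFlow κ c h) (hκ : 0 < κ) (x t : ℝ) :
    HasDerivAt (fun x => flowQ κ h x t) (κ * (flowQ κ h x t - flowW κ h x t)) x := by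
  obtain ⟨C, hC⟩ := H.boundedW hκ t
  exact hasDerivAt_bwd hκ (continuous_slice_left H.continuousW t) (fun y hy => hC y hy t le_rfl) x

theorem hasDerivAtV (H : IsReducedFlow κ c h) (hκ : 0 < κ) (x t : ℝ) :
    HasDerivAt (fun x => flowV κ h x t)
      (κ * (flowW κ h x t - flowQ κ h x t - flowV κ h x t)) x :=
  hasDerivAt_fwd κ ((continuous_slice_left H.continuousW t).sub
    (continuous_slice_left (H.continuousQ hκ) t)) x

theorem hasDerivAtW_time (H : IsReducedFlow κ c h) (hκ : 0 < κ) {x t : ℝ} (hx : 0 ≤ x)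
    (ht : 0 < t) : HasDerivAt (fun t => flowW κ h x t) (c * flowV κ h x t) t := by
  have hb : BoundedUpToTime fun x t => c * (flowW κ h x t - flowQ κ h x t) := fun T => by
    obtain ⟨C, hC⟩ := (H.boundedW hκ).sub (H.boundedQ hκ) T
    exact ⟨|c| * C, fun x hx t ht => by
      rw [abs_mul]; exact mul_le_mul_of_nonneg_left (hC x hx t ht) (abs_nonneg c)⟩
  have := hasDerivAt_fwd_param κ H.continuous
    (p' := fun x t => c * (flowW κ h x t - flowQ κ h x t))
    (continuous_const.mul (H.continuousW.sub (H.continuousQ hκ))) hb hx ht H.hasDerivAt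
  rwa [fwd_const_mul] at this

/-- The local conservation law for `h²`: its flux `w² / 2 - w q` vanishes at the boundary. -/
theorem integral_sq_eq (H : IsReducedFlow κ c h) (hκ : 0 < κ) {X T : ℝ} (hX : 0 ≤ X)
    (hT : 0 ≤ T) : ∫ x in (0 : ℝ)..X, h x T ^ 2 = (∫ x in (0 : ℝ)..X, h x 0 ^ 2) +
      2 * c / κ * ∫ t in (0 : ℝ)..T, (flowW κ h X t ^ 2 / 2 - flowW κ h X t * flowQ κ h X t) := by
  have := integral_sq_eq_of_conservation_law (a := h)
    (k := fun x t => flowW κ h x t - flowQ κ h x t)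
    (Φ := fun x t => (flowW κ h x t ^ 2 / 2 - flowW κ h x t * flowQ κ h x t) / κ) hX hT
    H.continuous (H.continuousW.sub (H.continuousQ hκ)) H.hasDerivAt fun t _ x => by
      have h1 := H.hasDerivAtW x t
      have h2 := H.hasDerivAtQ hκ x t
      refine ((((h1.pow 2).div_const 2).sub (h1.mul h2)).div_const κ).congr_deriv ?_
      simp only [Nat.cast_ofNat]
      field_simp
      ring
  rw [this]
  have h0 : ∀ t, flowW κ h 0 t = 0 := fun t => fwd_zero_right _ _
  simp only [h0]
  simp only [ne_eq, OfNat.ofNat_ne_zero, not_false_eq_true, zero_pow, zero_div, zero_mul, sub_zero,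
    intervalIntegral.integral_div]
  ring

/-- The local balance law for `w²`: since `v(0, t) = 0`, the boundary produces the
perfect square `q(0, t)²`. -/
theorem integral_sqW_eq (H : IsReducedFlow κ c h) (hκ : 0 < κ) {X T : ℝ} (hX : 0 ≤ X)
    (hT : 0 ≤ T) : ∫ x in (0 : ℝ)..X, flowW κ h x T ^ 2 =
      (∫ x in (0 : ℝ)..X, flowW κ h x 0 ^ 2) + c / κ * ((∫ t in (0 : ℝ)..T, flowQ κ h 0 t ^ 2) -
        ∫ t in (0 : ℝ)..T, (2 * (flowQ κ h X t * flowV κ h X t) + flowQ κ h X t ^ 2)) := by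
  have := integral_sq_eq_of_conservation_law (a := flowW κ h) (k := flowV κ h)
    (Φ := fun x t => -(flowQ κ h x t * flowV κ h x t + flowQ κ h x t ^ 2 / 2) / κ) hX hT
    H.continuousW (H.continuousV hκ) (fun x hx t ht => H.hasDerivAtW_time hκ hx ht)
    fun t _ x => by
      have h1 := H.hasDerivAtV hκ x t
      have h2 := H.hasDerivAtQ hκ x t
      refine (((h2.mul h1).add ((h2.pow 2).div_const 2)).neg.div_const κ).congr_deriv ?_
      simp only [Nat.cast_ofNat]
      field_simp
      ring
  rw [this]
  have h0 : ∀ t, flowV κ h 0 t = 0 := fun t => fwd_zero_right _ _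
  have c0 := continuous_slice_right (H.continuousQ hκ) 0
  have c1 := continuous_slice_right (H.continuousQ hκ) X
  have c2 := continuous_slice_right (H.continuousV hκ) X
  rw [← intervalIntegral.integral_sub (Continuous.intervalIntegrable (by fun_prop) _ _)
    (Continuous.intervalIntegrable (by fun_prop) _ _), ← intervalIntegral.integral_const_mul,
    ← intervalIntegral.integral_const_mul]
  congr 1
  refine intervalIntegral.integral_congr fun t _ => ?_
  simp only [h0]
  field_simp
  ring

/-- `∫ w² + κ⁻² ∫ w_x² ≤ ∫ h²` on `[0, X]`: the cross term `2 w w_x / κ` integrates to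
`w(X)² / κ ≥ 0`. -/
theorem integral_sqW_add_le (H : IsReducedFlow κ c h) (hκ : 0 < κ) (X t : ℝ) :
    (∫ x in (0 : ℝ)..X, flowW κ h x t ^ 2) +
      (∫ x in (0 : ℝ)..X, (h x t - flowW κ h x t) ^ 2) ≤ ∫ x in (0 : ℝ)..X, h x t ^ 2 := by
  have c0 := continuous_slice_left H.continuous t
  have c1 := continuous_slice_left H.continuousW t
  have h1 : ∫ x in (0 : ℝ)..X, 2 * (flowW κ h x t * (κ * (h x t - flowW κ h x t)))
      = flowW κ h X t ^ 2 - flowW κ h 0 t ^ 2 :=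
    intervalIntegral.integral_eq_sub_of_hasDerivAt (f := fun x => flowW κ h x t ^ 2) (fun x _ =>
      ((H.hasDerivAtW x t).pow 2).congr_deriv (by simp only [Nat.cast_ofNat]; ring))
      (Continuous.intervalIntegrable (by fun_prop) _ _)
  have h0 : flowW κ h 0 t = 0 := fwd_zero_right _ _
  have h2 : ∫ x in (0 : ℝ)..X, h x t ^ 2 = ((∫ x in (0 : ℝ)..X, flowW κ h x t ^ 2) +
      (∫ x in (0 : ℝ)..X, (h x t - flowW κ h x t) ^ 2)) + κ⁻¹ *
      ∫ x in (0 : ℝ)..X, 2 * (flowW κ h x t * (κ * (h x t - flowW κ h x t))) := by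
    rw [← intervalIntegral.integral_const_mul,
      ← intervalIntegral.integral_add (Continuous.intervalIntegrable (by fun_prop) _ _)
      (Continuous.intervalIntegrable (by fun_prop) _ _),
      ← intervalIntegral.integral_add (Continuous.intervalIntegrable (by fun_prop) _ _)
      (Continuous.intervalIntegrable (by fun_prop) _ _)]
    refine intervalIntegral.integral_congr fun x _ => ?_
    field_simp
    ring
  rw [h2, h1, h0, zero_pow two_ne_zero, sub_zero]
  have : 0 ≤ κ⁻¹ * flowW κ h X t ^ 2 := by positivity
  linarith

theorem integral_sqW_le (H : IsReducedFlow κ c h) (hκ : 0 < κ) {X : ℝ} (hX : 0 ≤ X) (t : ℝ) :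
    ∫ x in (0 : ℝ)..X, flowW κ h x t ^ 2 ≤ ∫ x in (0 : ℝ)..X, h x t ^ 2 := by
  have h1 := H.integral_sqW_add_le hκ X t
  have h2 := intervalIntegral.integral_nonneg (μ := volume) hX
    (fun x _ => sq_nonneg (h x t - flowW κ h x t))
  linarith

variable {E : ℝ}

/-- The flux of `h²` is bounded up to each time, so `h(t)` stays square integrable. -/
theorem exists_integral_sq_le (H : IsReducedFlow κ c h) (hκ : 0 < κ)
    (hE : ∀ X, 0 ≤ X → ∫ x in (0 : ℝ)..X, h x 0 ^ 2 ≤ E) {T : ℝ} (hT : 0 ≤ T) :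
    ∃ C, ∀ X, 0 ≤ X → ∫ x in (0 : ℝ)..X, h x T ^ 2 ≤ C := by
  obtain ⟨A, hA⟩ := H.boundedW hκ T
  obtain ⟨B, hB⟩ := H.boundedQ hκ T
  refine ⟨E + |2 * c / κ| * ((A ^ 2 / 2 + A * B) * |T - 0|), fun X hX => ?_⟩
  rw [H.integral_sq_eq hκ hX hT]
  refine add_le_add (hE X hX) ((le_abs_self _).trans ?_)
  rw [abs_mul]
  refine mul_le_mul_of_nonneg_left ?_ (abs_nonneg _)
  rw [← Real.norm_eq_abs]
  refine intervalIntegral.norm_integral_le_of_norm_le_const fun t ht => ?_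
  rw [uIoc_of_le hT] at ht
  have h1 := hA X hX t ht.2
  have h2 := hB X hX t ht.2
  rw [Real.norm_eq_abs]
  refine (abs_sub _ _).trans ?_
  rw [abs_mul, abs_of_nonneg (by positivity : 0 ≤ flowW κ h X t ^ 2 / 2), ← sq_abs]
  gcongr
  exact (abs_nonneg _).trans h1

theorem tendstoW_atTop (H : IsReducedFlow κ c h) (hκ : 0 < κ)
    (hE : ∀ X, 0 ≤ X → ∫ x in (0 : ℝ)..X, h x 0 ^ 2 ≤ E) {t : ℝ} (ht : 0 ≤ t) :
    Tendsto (fun x => flowW κ h x t) atTop (𝓝 0) := by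
  obtain ⟨C, hC⟩ := H.exists_integral_sq_le hκ hE ht
  obtain ⟨A, hA⟩ := H.boundedW hκ t
  obtain ⟨B, hB⟩ := H.bounded t
  refine tendsto_zero_of_lipschitz_of_integral_sq_le (K := κ * (B + A))
    (continuous_slice_left H.continuousW t) (fun x y hx hy =>
      abs_sub_le_of_hasDerivAt (fun x _ => H.hasDerivAtW x t) (fun x hx => ?_) hx hy)
    fun X hX => (H.integral_sqW_le hκ hX t).trans (hC X hX)
  rw [abs_mul, abs_of_pos hκ]
  exact mul_le_mul_of_nonneg_left ((abs_sub _ _).trans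
    (add_le_add (hB x hx.le t le_rfl) (hA x hx.le t le_rfl))) hκ.le

theorem tendstoQ_atTop (H : IsReducedFlow κ c h) (hκ : 0 < κ)
    (hE : ∀ X, 0 ≤ X → ∫ x in (0 : ℝ)..X, h x 0 ^ 2 ≤ E) {t : ℝ} (ht : 0 ≤ t) :
    Tendsto (fun x => flowQ κ h x t) atTop (𝓝 0) :=
  tendsto_bwd_zero hκ (H.tendstoW_atTop hκ hE ht)

/-- Conservation of energy: no flux of `h²` escapes to infinity. -/
theorem integral_sq_le (H : IsReducedFlow κ c h) (hκ : 0 < κ)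
    (hE : ∀ X, 0 ≤ X → ∫ x in (0 : ℝ)..X, h x 0 ^ 2 ≤ E) {X T : ℝ} (hX : 0 ≤ X) (hT : 0 ≤ T) :
    ∫ x in (0 : ℝ)..X, h x T ^ 2 ≤ E := by
  obtain ⟨A, hA⟩ := H.boundedW hκ T
  obtain ⟨B, hB⟩ := H.boundedQ hκ T
  have hlim : Tendsto (fun Y => ∫ t in (0 : ℝ)..T,
      (flowW κ h Y t ^ 2 / 2 - flowW κ h Y t * flowQ κ h Y t)) atTop
      (𝓝 (∫ _ in (0 : ℝ)..T, 0)) := by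
    refine intervalIntegral.tendsto_integral_filter_of_dominated_convergence
      (fun _ => A ^ 2 / 2 + A * B) ?_ ?_ (by simp) ?_
    · refine Eventually.of_forall fun Y => Continuous.aestronglyMeasurable ?_
      have := continuous_slice_right H.continuousW Y
      have := continuous_slice_right (H.continuousQ hκ) Y
      fun_prop
    · filter_upwards [eventually_ge_atTop 0] with Y hY
      refine Eventually.of_forall fun t ht => ?_
      rw [uIoc_of_le hT] at ht
      have h1 := hA Y hY t ht.2
      have h2 := hB Y hY t ht.2
      rw [Real.norm_eq_abs]
      refine (abs_sub _ _).trans ?_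
      rw [abs_mul, abs_of_nonneg (by positivity : 0 ≤ flowW κ h Y t ^ 2 / 2), ← sq_abs]
      gcongr
      exact (abs_nonneg _).trans h1
    · refine Eventually.of_forall fun t ht => ?_
      rw [uIoc_of_le hT] at ht
      have h1 := H.tendstoW_atTop hκ hE ht.1.le
      have h2 := H.tendstoQ_atTop hκ hE ht.1.le
      simpa using ((h1.pow 2).div_const 2).sub (h1.mul h2)
  rw [intervalIntegral.integral_zero] at hlim
  have hlim' := (hlim.const_mul (2 * c / κ)).const_add E
  rw [mul_zero, add_zero] at hlim'
  refine ge_of_tendsto hlim' ?_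
  filter_upwards [eventually_ge_atTop X] with Y hY
  have hint : ∀ a b, IntervalIntegrable (fun x => h x T ^ 2) volume a b := fun a b => by
    have := continuous_slice_left H.continuous T
    exact Continuous.intervalIntegrable (by fun_prop) _ _
  have h1 : ∫ x in (0 : ℝ)..X, h x T ^ 2 ≤ ∫ x in (0 : ℝ)..Y, h x T ^ 2 := by
    rw [← intervalIntegral.integral_add_adjacent_intervals (hint 0 X) (hint X Y)]
    have := intervalIntegral.integral_nonneg (μ := volume) hY (fun x _ => sq_nonneg (h x T))
    linarith
  rw [H.integral_sq_eq hκ (hX.trans hY) hT] at h1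
  linarith [hE Y (hX.trans hY)]

/-- The boundary term in the balance of `∫ w²` is square integrable in time, because `∫ w²` is
bounded by the conserved energy. -/
theorem integral_sq_boundary_le (H : IsReducedFlow κ c h) (hκ : 0 < κ) (hc : c ≠ 0)
    (hE : ∀ X, 0 ≤ X → ∫ x in (0 : ℝ)..X, h x 0 ^ 2 ≤ E) {T : ℝ} (hT : 0 ≤ T) :
    ∫ t in (0 : ℝ)..T, flowQ κ h 0 t ^ 2 ≤ κ / |c| * E := by
  obtain ⟨A, hA⟩ := H.boundedV hκ T
  obtain ⟨B, hB⟩ := H.boundedQ hκ T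
  have hlim : Tendsto (fun Y => ∫ t in (0 : ℝ)..T,
      (2 * (flowQ κ h Y t * flowV κ h Y t) + flowQ κ h Y t ^ 2)) atTop
      (𝓝 (∫ _ in (0 : ℝ)..T, 0)) := by
    refine intervalIntegral.tendsto_integral_filter_of_dominated_convergence
      (fun _ => 2 * (B * A) + B ^ 2) ?_ ?_ (by simp) ?_
    · refine Eventually.of_forall fun Y => Continuous.aestronglyMeasurable ?_
      have := continuous_slice_right (H.continuousV hκ) Y
      have := continuous_slice_right (H.continuousQ hκ) Y
      fun_prop
    · filter_upwards [eventually_ge_atTop 0] with Y hY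
      refine Eventually.of_forall fun t ht => ?_
      rw [uIoc_of_le hT] at ht
      have h1 := hA Y hY t ht.2
      have h2 := hB Y hY t ht.2
      rw [Real.norm_eq_abs]
      refine (abs_add_le _ _).trans ?_
      rw [abs_mul, abs_mul, abs_of_pos (two_pos : (0 : ℝ) < 2),
        abs_of_nonneg (sq_nonneg (flowQ κ h Y t)), ← sq_abs (flowQ κ h Y t)]
      gcongr
      exact (abs_nonneg _).trans h2
    · refine Eventually.of_forall fun t ht => ?_
      rw [uIoc_of_le hT] at ht
      have h2 := H.tendstoQ_atTop hκ hE ht.1.le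
      have h3 : Tendsto (fun Y => flowQ κ h Y t * flowV κ h Y t) atTop (𝓝 0) := by
        refine squeeze_zero_norm' (a := fun Y => |flowQ κ h Y t| * A) ?_
          (by simpa using h2.abs.mul_const A)
        filter_upwards [eventually_ge_atTop 0] with Y hY
        rw [Real.norm_eq_abs, abs_mul]
        exact mul_le_mul_of_nonneg_left (hA Y hY t ht.2) (abs_nonneg _)
      simpa using (h3.const_mul 2).add (h2.pow 2)
  rw [intervalIntegral.integral_zero] at hlim
  set Q := ∫ t in (0 : ℝ)..T, flowQ κ h 0 t ^ 2
  have hlim' := ((hlim.const_sub Q).const_mul (c / κ)).abs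
  rw [sub_zero] at hlim'
  have hle : |c / κ * Q| ≤ E := by
    refine le_of_tendsto hlim' ?_
    filter_upwards [eventually_ge_atTop 0] with Y hY
    have h1 := H.integral_sqW_eq hκ hY hT
    have h2 := (H.integral_sqW_le hκ hY T).trans (H.integral_sq_le hκ hE hY hT)
    have h3 := (H.integral_sqW_le hκ hY 0).trans (hE Y hY)
    have h4 := intervalIntegral.integral_nonneg (μ := volume) hY
      (fun x _ => sq_nonneg (flowW κ h x T))
    have h5 := intervalIntegral.integral_nonneg (μ := volume) hY
      (fun x _ => sq_nonneg (flowW κ h x 0))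
    rw [abs_le]
    constructor <;> linarith
  have hQ : 0 ≤ Q := intervalIntegral.integral_nonneg (μ := volume) hT
      (fun t _ => sq_nonneg (flowQ κ h 0 t))
  rw [abs_mul, abs_div, abs_of_pos hκ, abs_of_nonneg hQ] at hle
  have hc' : 0 < |c| := abs_pos.2 hc
  calc Q = κ / |c| * (|c| / κ * Q) := by field_simp
    _ ≤ κ / |c| * E := by gcongr

/-- Uniform bound: `(w²)_x = 2κ (h w - w²) ≤ (κ/2) h²`. -/
theorem absW_le (H : IsReducedFlow κ c h) (hκ : 0 < κ)
    (hE : ∀ X, 0 ≤ X → ∫ x in (0 : ℝ)..X, h x 0 ^ 2 ≤ E) {x t : ℝ} (hx : 0 ≤ x) (ht : 0 ≤ t) :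
    |flowW κ h x t| ≤ √(κ / 2 * E) := by
  have c0 := continuous_slice_left H.continuous t
  have c1 := continuous_slice_left H.continuousW t
  have h1 : ∫ x in (0 : ℝ)..x, 2 * (flowW κ h x t * (κ * (h x t - flowW κ h x t)))
      = flowW κ h x t ^ 2 - flowW κ h 0 t ^ 2 :=
    intervalIntegral.integral_eq_sub_of_hasDerivAt (f := fun x => flowW κ h x t ^ 2) (fun x _ =>
      ((H.hasDerivAtW x t).pow 2).congr_deriv (by simp only [Nat.cast_ofNat]; ring))
      (Continuous.intervalIntegrable (by fun_prop) _ _)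
  have h0 : flowW κ h 0 t = 0 := fwd_zero_right _ _
  have h2 : ∫ x in (0 : ℝ)..x, 2 * (flowW κ h x t * (κ * (h x t - flowW κ h x t)))
      ≤ ∫ x in (0 : ℝ)..x, κ / 2 * h x t ^ 2 := by
    refine intervalIntegral.integral_mono_on hx (Continuous.intervalIntegrable (by fun_prop) _ _)
      (Continuous.intervalIntegrable (by fun_prop) _ _) fun y _ => ?_
    nlinarith [mul_nonneg hκ.le (sq_nonneg (h y t - 2 * flowW κ h y t))]
  rw [h1, intervalIntegral.integral_const_mul, h0] at h2
  refine Real.abs_le_sqrt ?_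
  have := mul_le_mul_of_nonneg_left (H.integral_sq_le hκ hE hx ht) (by positivity : 0 ≤ κ / 2)
  linarith

/-- Uniform equicontinuity in `x`, from the uniform bound on `∫ w_x²`. -/
theorem abs_subW_le (H : IsReducedFlow κ c h) (hκ : 0 < κ)
    (hE : ∀ X, 0 ≤ X → ∫ x in (0 : ℝ)..X, h x 0 ^ 2 ≤ E) {x y t a : ℝ} (ha : 0 < a) (hx : 0 ≤ x)
    (hxy : x ≤ y) (ht : 0 ≤ t) :
    |flowW κ h y t - flowW κ h x t| ≤ κ * (a * (y - x) + E / a) := by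
  have c0 := continuous_slice_left H.continuous t
  have c1 := continuous_slice_left H.continuousW t
  have hi : ∀ u v, IntervalIntegrable (fun x => (h x t - flowW κ h x t) ^ 2) volume u v :=
    fun u v => Continuous.intervalIntegrable (by fun_prop) _ _
  have h1 : ∫ z in x..y, κ * (h z t - flowW κ h z t) = flowW κ h y t - flowW κ h x t :=
    intervalIntegral.integral_eq_sub_of_hasDerivAt (f := fun x => flowW κ h x t)
      (fun x _ => H.hasDerivAtW x t) (Continuous.intervalIntegrable (by fun_prop) _ _)
  have h2 : ∫ z in x..y, (h z t - flowW κ h z t) ^ 2 ≤ E := by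
    have h3 := intervalIntegral.integral_add_adjacent_intervals (hi 0 x) (hi x y)
    have h4 := intervalIntegral.integral_nonneg (μ := volume) hx
      (fun x _ => sq_nonneg (h x t - flowW κ h x t))
    have h5 := intervalIntegral.integral_nonneg (μ := volume) (hx.trans hxy)
      (fun x _ => sq_nonneg (flowW κ h x t))
    have h6 := H.integral_sqW_add_le hκ y t
    have h7 := H.integral_sq_le hκ hE (hx.trans hxy) ht
    linarith
  rw [← h1, intervalIntegral.integral_const_mul, abs_mul, abs_of_pos hκ]
  refine mul_le_mul_of_nonneg_left ?_ hκ.le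
  refine (intervalIntegral.abs_integral_le_integral_abs hxy).trans ?_
  have h3 : ∫ z in x..y, |h z t - flowW κ h z t|
      ≤ ∫ z in x..y, (a + a⁻¹ * (h z t - flowW κ h z t) ^ 2) := by
    refine intervalIntegral.integral_mono_on hxy (Continuous.intervalIntegrable (by fun_prop) _ _)
      (Continuous.intervalIntegrable (by fun_prop) _ _) fun z _ => ?_
    rw [← sq_abs]
    set m := |h z t - flowW κ h z t|
    have h4 : a * m ≤ a * (a + a⁻¹ * m ^ 2) := by
      have : a * (a + a⁻¹ * m ^ 2) = a ^ 2 + m ^ 2 := by field_simp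
      rw [this]; nlinarith [sq_nonneg (a - m), sq_nonneg a, sq_nonneg m]
    exact le_of_mul_le_mul_left h4 ha
  refine h3.trans ?_
  rw [intervalIntegral.integral_add (by simp) ((hi x y).const_mul _),
    intervalIntegral.integral_const_mul, intervalIntegral.integral_const, smul_eq_mul, div_eq_inv_mul,
    mul_comm a]
  gcongr

end IsReducedFlow

/-! ### Decay of the reduced flow -/

namespace IsReducedFlow

variable {κ c E : ℝ} {h : ℝ → ℝ → ℝ}

theorem absQ_le (H : IsReducedFlow κ c h) (hκ : 0 < κ)
    (hE : ∀ X, 0 ≤ X → ∫ x in (0 : ℝ)..X, h x 0 ^ 2 ≤ E) {x t : ℝ} (hx : 0 ≤ x) (ht : 0 ≤ t) :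
    |flowQ κ h x t| ≤ √(κ / 2 * E) :=
  abs_bwd_le hκ fun _ hy => H.absW_le hκ hE (hx.trans hy) ht

theorem absV_le (H : IsReducedFlow κ c h) (hκ : 0 < κ)
    (hE : ∀ X, 0 ≤ X → ∫ x in (0 : ℝ)..X, h x 0 ^ 2 ≤ E) {x t : ℝ} (hx : 0 ≤ x) (ht : 0 ≤ t) :
    |flowV κ h x t| ≤ √(κ / 2 * E) + √(κ / 2 * E) :=
  abs_fwd_le hκ hx fun _ hy _ => (abs_sub _ _).trans
    (add_le_add (H.absW_le hκ hE hy ht) (H.absQ_le hκ hE hy ht))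

theorem hasDerivAt_moment (H : IsReducedFlow κ c h) (hκ : 0 < κ) {s t : ℝ} (hs : 0 < s)
    (ht : 0 < t) : HasDerivAt (fun t => ∫ x in Ioi 0, Real.exp (-s * x) * flowW κ h x t)
      (c * ∫ x in Ioi 0, Real.exp (-s * x) * flowV κ h x t) t := by
  have hb : BoundedUpToTime fun x t => c * flowV κ h x t := fun T => by
    obtain ⟨C, hC⟩ := H.boundedV hκ T
    exact ⟨|c| * C, fun x hx t ht => by
      rw [abs_mul]; exact mul_le_mul_of_nonneg_left (hC x hx t ht) (abs_nonneg c)⟩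
  refine (hasDerivAt_integral_exp_mul hs H.continuousW (H.boundedW hκ)
    (continuous_const.mul (H.continuousV hκ)) hb le_rfl ht
    fun y hy t ht => H.hasDerivAtW_time hκ hy ht).congr_deriv ?_
  rw [← integral_const_mul]
  refine integral_congr_ae (Eventually.of_forall fun x => ?_)
  simp only; ring

theorem flowQ_zero (κ : ℝ) (h : ℝ → ℝ → ℝ) (t : ℝ) :
    flowQ κ h 0 t = κ * ∫ x in Ioi 0, Real.exp (-κ * x) * flowW κ h x t := by
  simp [flowQ, bwd]

theorem tendsto_boundary (H : IsReducedFlow κ c h) (hκ : 0 < κ) (hc : c ≠ 0)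
    (hE : ∀ X, 0 ≤ X → ∫ x in (0 : ℝ)..X, h x 0 ^ 2 ≤ E) :
    Tendsto (fun t => flowQ κ h 0 t) atTop (𝓝 0) := by
  set M := √(κ / 2 * E)
  refine tendsto_zero_of_lipschitz_of_integral_sq_le (K := κ * (|c| * (1 / κ * (M + M))))
    (continuous_slice_right (H.continuousQ hκ) 0) (fun t s ht hs => ?_)
    fun T hT => H.integral_sq_boundary_le hκ hc hE hT
  refine abs_sub_le_of_hasDerivAt (f := fun t => flowQ κ h 0 t)
    (f' := fun t => κ * (c * ∫ x in Ioi 0, Real.exp (-κ * x) * flowV κ h x t))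
    (fun t ht => ?_) (fun t ht => ?_) ht hs
  · simp only [flowQ_zero]
    exact (H.hasDerivAt_moment hκ hκ ht).const_mul κ
  · rw [abs_mul, abs_mul, abs_of_pos hκ]
    have := abs_integral_exp_mul_le (a := 0) hκ fun y hy => H.absV_le hκ hE hy ht.le
    rw [mul_zero, Real.exp_zero] at this
    gcongr

/-- The Laplace transform in `x` of `w_t`, in terms of those of `w` and of `q(0, t)`. -/
theorem laplace_velocity (H : IsReducedFlow κ c h) (hκ : 0 < κ) {s t : ℝ} (hs : 0 < s)
    (hsκ : s ≠ κ) :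
    ∫ x in Ioi 0, Real.exp (-s * x) * flowV κ h x t = κ / ((s + κ) * (s - κ)) *
      (s * (∫ x in Ioi 0, Real.exp (-s * x) * flowW κ h x t) - flowQ κ h 0 t) := by
  obtain ⟨A, hA⟩ := H.boundedW hκ t
  obtain ⟨B, hB⟩ := H.boundedQ hκ t
  obtain ⟨C, hC⟩ := H.boundedV hκ t
  have cW := continuous_slice_left H.continuousW t
  have cQ := continuous_slice_left (H.continuousQ hκ) t
  have cV := continuous_slice_left (H.continuousV hκ) t
  have bW : ∀ y, 0 ≤ y → |flowW κ h y t| ≤ A := fun y hy => hA y hy t le_rfl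
  have bQ : ∀ y, 0 ≤ y → |flowQ κ h y t| ≤ B := fun y hy => hB y hy t le_rfl
  have bV : ∀ y, 0 ≤ y → |flowV κ h y t| ≤ C := fun y hy => hC y hy t le_rfl
  have iW := integrableOn_exp_mul_of_bounded hs cW bW
  have iQ := integrableOn_exp_mul_of_bounded hs cQ bQ
  have iV := integrableOn_exp_mul_of_bounded hs cV bV
  have h1 := integral_exp_mul_deriv hs (fun x => H.hasDerivAtQ hκ x t) (by fun_prop) bQ
    (C' := κ * (B + A)) fun y hy => by
      rw [abs_mul, abs_of_pos hκ]
      have := (abs_sub (flowQ κ h y t) (flowW κ h y t)).trans (add_le_add (bQ y hy) (bW y hy))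
      gcongr
  have h2 := integral_exp_mul_deriv hs (fun x => H.hasDerivAtV hκ x t) (by fun_prop) bV
    (C' := κ * (A + B + C)) fun y hy => by
      rw [abs_mul, abs_of_pos hκ]
      have h3 := (abs_sub (flowW κ h y t) (flowQ κ h y t)).trans (add_le_add (bW y hy) (bQ y hy))
      have h4 := (abs_sub (flowW κ h y t - flowQ κ h y t) (flowV κ h y t)).trans
        (add_le_add h3 (bV y hy))
      gcongr
  have e1 : ∫ x in Ioi 0, Real.exp (-s * x) * (κ * (flowQ κ h x t - flowW κ h x t))
      = κ * ((∫ x in Ioi 0, Real.exp (-s * x) * flowQ κ h x t)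
        - ∫ x in Ioi 0, Real.exp (-s * x) * flowW κ h x t) := by
    rw [← integral_sub iQ iW, ← integral_const_mul]
    exact integral_congr_ae (Eventually.of_forall fun x => by simp only; ring)
  have e2 : ∫ x in Ioi 0, Real.exp (-s * x) * (κ * (flowW κ h x t - flowQ κ h x t - flowV κ h x t))
      = κ * ((∫ x in Ioi 0, Real.exp (-s * x) * flowW κ h x t)
        - (∫ x in Ioi 0, Real.exp (-s * x) * flowQ κ h x t)
        - ∫ x in Ioi 0, Real.exp (-s * x) * flowV κ h x t) := by
    have iWQ : IntegrableOn (fun x => Real.exp (-s * x) * flowW κ h x t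
        - Real.exp (-s * x) * flowQ κ h x t) (Ioi 0) := iW.sub iQ
    rw [← integral_sub iW iQ, ← integral_sub iWQ iV, ← integral_const_mul]
    exact integral_congr_ae (Eventually.of_forall fun x => by simp only; ring)
  rw [e1] at h1
  have hv0 : flowV κ h 0 t = 0 := fwd_zero_right _ _
  rw [e2, hv0] at h2
  have n1 : s + κ ≠ 0 := by positivity
  have n2 : s - κ ≠ 0 := sub_ne_zero.2 hsκ
  rw [div_mul_eq_mul_div, eq_div_iff (mul_ne_zero n1 n2)]
  linear_combination (-(s - κ)) * h2 + κ * h1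

/-- The flow decays pointwise. The square integrability of the boundary trace `q(0, t)` makes it
tend to `0`; it drives the scalar equation of each exponential moment of `w`. -/
theorem tendsto_zero (H : IsReducedFlow κ c h) (hκ : 0 < κ) (hc : c ≠ 0)
    (hE : ∀ X, 0 ≤ X → ∫ x in (0 : ℝ)..X, h x 0 ^ 2 ≤ E) {x : ℝ} (hx : 0 < x) :
    Tendsto (fun t => flowW κ h x t) atTop (𝓝 0) := by
  set M := √(κ / 2 * E) with hM
  have hE0 : 0 ≤ E := by simpa using hE 0 le_rfl
  refine tendsto_zero_of_tendsto_exp_moments hκ (continuous_slice_left H.continuousW)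
    (fun t ht y hy => H.absW_le hκ hE hy ht) (fun n hn => ?_) hx fun ε hε => ?_
  · have hn' : (2 : ℝ) ≤ n := by exact_mod_cast hn
    have hs : 0 < n * κ := by positivity
    have hsκ : n * κ ≠ κ := by nlinarith
    have hsκ' : n * κ - κ ≠ 0 := sub_ne_zero.2 hsκ
    refine tendsto_zero_of_linear_ode (l := c * κ * (n * κ) / ((n * κ + κ) * (n * κ - κ)))
      (m := fun t => -(c * κ / ((n * κ + κ) * (n * κ - κ))) * flowQ κ h 0 t)
      (C := 1 / (n * κ) * M) (by positivity) (fun t ht => ?_) (fun t ht => ?_) ?_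
    · refine (H.hasDerivAt_moment hκ hs ht).congr_deriv ?_
      rw [H.laplace_velocity hκ hs hsκ]
      ring
    · have := abs_integral_exp_mul_le (a := 0) hs fun y hy => H.absW_le hκ hE hy ht.le
      rwa [mul_zero, Real.exp_zero] at this
    · simpa using (H.tendsto_boundary hκ hc hE).const_mul
        (-(c * κ / ((n * κ + κ) * (n * κ - κ))))
  · -- Choose `a` with `κ E / a ≤ ε / 2`, then `δ` with `κ a δ ≤ ε / 2`.
    set a := 2 * κ * (E + 1) / ε with ha
    have ha0 : 0 < a := by positivity
    have h1 : κ * (E / a) ≤ ε / 2 := by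
      have : κ * (E / a) = ε / 2 * (E / (E + 1)) := by rw [ha]; field_simp
      rw [this]
      have : E / (E + 1) ≤ 1 := by rw [div_le_one (by positivity)]; linarith
      nlinarith
    refine ⟨ε / (2 * κ * a), by positivity, fun t ht y hy hyx => ?_⟩
    have key : ∀ u v, 0 ≤ u → u ≤ v → v - u ≤ ε / (2 * κ * a) →
        |flowW κ h v t - flowW κ h u t| ≤ ε := fun u v hu huv hd => by
      have h2 := H.abs_subW_le hκ hE ha0 hu huv ht
      have h3 := mul_le_mul_of_nonneg_left hd (by positivity : 0 ≤ κ * a)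
      have h4 : κ * a * (ε / (2 * κ * a)) = ε / 2 := by field_simp
      linarith
    rcases le_total x y with hxy | hxy
    · exact key x y hx.le hxy ((le_abs_self _).trans hyx)
    · rw [abs_sub_comm] at hyx ⊢
      exact key y x hy hxy ((le_abs_self _).trans hyx)

end IsReducedFlow

/-! ### Weak solutions on the open half line -/

/-- Fubini's theorem on the half plane `x < y`. -/
theorem integral_mul_integral_Ioi_eq {a b : ℝ → ℝ} (ha : Integrable a) (hb : Integrable b) :
    ∫ x, a x * ∫ y in Ioi x, b y = ∫ y, b y * ∫ x in Iio y, a x := by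
  have hS : MeasurableSet {z : ℝ × ℝ | z.1 < z.2} := measurableSet_lt measurable_fst measurable_snd
  have hint : Integrable (Function.uncurry fun x y : ℝ => if x < y then a x * b y else 0)
      (volume.prod volume) := by
    refine ((ha.mul_prod hb).indicator hS).congr (Eventually.of_forall fun z => ?_)
    simp only [indicator, mem_ofPred_eq, Function.uncurry]
  have h := integral_integral_swap hint
  have h1 : ∀ x, ∫ y, (if x < y then a x * b y else 0) = a x * ∫ y in Ioi x, b y := fun x => by
    rw [← integral_const_mul, ← integral_indicator measurableSet_Ioi]
    rfl
  have h2 : ∀ y, ∫ x, (if x < y then a x * b y else 0) = b y * ∫ x in Iio y, a x := fun y => by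
    rw [← integral_const_mul, ← integral_indicator measurableSet_Iio]
    refine integral_congr_ae (Eventually.of_forall fun x => ?_)
    simp only [indicator, mem_Iio, mul_comm]
  simpa only [h1, h2] using h

/-! The next lemmas treat `bwd κ F` for `F ∈ L¹`, which need not be differentiable everywhere; they
rest on Fubini's theorem instead of integration by parts. -/

theorem integrable_exp_neg_mul_of_eq_zero {κ : ℝ} (hκ : 0 < κ) {F : ℝ → ℝ} (hF : Integrable F)
    (h0 : ∀ y, y < 0 → F y = 0) : Integrable fun y => Real.exp (-κ * y) * F y := by
  refine hF.mono (Continuous.aestronglyMeasurable (by fun_prop) |>.mul hF.1)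
    (Eventually.of_forall fun y => ?_)
  rcases lt_or_ge y 0 with hy | hy
  · simp [h0 y hy]
  · rw [norm_mul, Real.norm_eq_abs, Real.abs_exp]
    have : Real.exp (-κ * y) ≤ 1 := Real.exp_le_one_iff.2 (by nlinarith)
    nlinarith [norm_nonneg (F y)]

theorem continuous_bwd_of_integrable {κ : ℝ} (hκ : 0 < κ) {F : ℝ → ℝ} (hF : Integrable F)
    (h0 : ∀ y, y < 0 → F y = 0) : Continuous (bwd κ F) := by
  have hi := integrable_exp_neg_mul_of_eq_zero hκ hF h0
  rw [show bwd κ F = _ from funext fun x => bwd_eq 0 (fun b => hi.integrableOn) x]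
  have := hi.continuous_primitive 0
  fun_prop

theorem abs_bwd_le_of_integrable {κ : ℝ} (hκ : 0 < κ) {F : ℝ → ℝ} (hF : Integrable F) (x : ℝ) :
    |bwd κ F x| ≤ κ * ∫ y, |F y| := by
  refine (abs_bwd_le_bwd_abs hκ F x).trans ?_
  unfold bwd
  rw [mul_assoc, ← integral_const_mul]
  refine mul_le_mul_of_nonneg_left ?_ hκ.le
  refine (integral_mono_of_nonneg (Eventually.of_forall fun y => by positivity)
    hF.abs.integrableOn ?_).trans
    (setIntegral_le_integral hF.abs (Eventually.of_forall fun y => abs_nonneg _))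
  refine (ae_restrict_mem measurableSet_Ioi).mono fun y hy => ?_
  have h1 : Real.exp (κ * x) * Real.exp (-κ * y) ≤ 1 := by
    rw [← Real.exp_add, Real.exp_le_one_iff]
    have : x < y := hy
    nlinarith
  have := mul_le_mul_of_nonneg_right h1 (abs_nonneg (F y))
  simp only
  linarith

/-- `bwd κ` is a contraction of `L¹`, since its kernel has mass at most `1` in `x`. -/
theorem integral_abs_bwd_le {κ : ℝ} (hκ : 0 < κ) {F : ℝ → ℝ} (hF : Integrable F)
    (h0 : ∀ y, y < 0 → F y = 0) {X : ℝ} (hX : 0 ≤ X) :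
    ∫ x in (0 : ℝ)..X, |bwd κ F x| ≤ ∫ y, |F y| := by
  have hb : Integrable fun y => Real.exp (-κ * y) * |F y| :=
    integrable_exp_neg_mul_of_eq_zero hκ hF.abs fun y hy => by rw [h0 y hy, abs_zero]
  have ha : Integrable ((Ioc 0 X).indicator fun x => κ * Real.exp (κ * x)) := by
    rw [integrable_indicator_iff measurableSet_Ioc]
    exact Continuous.integrableOn_Ioc (by fun_prop)
  have h1 : ∫ x in (0 : ℝ)..X, |bwd κ F x| ≤ ∫ x in (0 : ℝ)..X, bwd κ (fun y => |F y|) x :=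
    intervalIntegral.integral_mono hX
      ((continuous_bwd_of_integrable hκ hF h0).abs.intervalIntegrable _ _)
      ((continuous_bwd_of_integrable hκ hF.abs fun y hy => by
        rw [h0 y hy, abs_zero]).intervalIntegrable _ _)
      (fun x => abs_bwd_le_bwd_abs hκ F x)
  have h2 : ∫ x in (0 : ℝ)..X, bwd κ (fun y => |F y|) x =
      ∫ x, (Ioc 0 X).indicator (fun x => κ * Real.exp (κ * x)) x *
        ∫ y in Ioi x, Real.exp (-κ * y) * |F y| := by
    rw [intervalIntegral.integral_of_le hX, ← integral_indicator measurableSet_Ioc]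
    refine integral_congr_ae (Eventually.of_forall fun x => ?_)
    simp only [indicator, bwd]
    split_ifs <;> simp
  refine h1.trans (h2.le.trans ?_)
  rw [integral_mul_integral_Ioi_eq ha hb]
  have hexp : ∀ y, IntegrableOn (fun x => κ * Real.exp (κ * x)) (Iic y) := fun y =>
    (integrableOn_exp_mul_Iic hκ y).const_mul κ
  have h3 : ∀ y, 0 ≤ ∫ x in Iio y, (Ioc 0 X).indicator (fun x => κ * Real.exp (κ * x)) x :=
    fun y => integral_nonneg fun x => indicator_nonneg (fun x _ => by positivity) x
  refine integral_mono_of_nonneg (Eventually.of_forall fun y =>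
    mul_nonneg (by positivity) (h3 y)) hF.abs (Eventually.of_forall fun y => ?_)
  have h4 : ∫ x in Iio y, (Ioc 0 X).indicator (fun x => κ * Real.exp (κ * x)) x
      ≤ Real.exp (κ * y) := by
    rw [← integral_Iic_eq_integral_Iio]
    refine (setIntegral_mono ha.integrableOn (hexp y) (indicator_le_self' fun x _ => by
      positivity)).trans_eq ?_
    rw [integral_const_mul, integral_exp_mul_Iic hκ]
    field_simp
  have h5 : Real.exp (-κ * y) * Real.exp (κ * y) = 1 := by rw [← Real.exp_add]; simp
  have h6 := mul_le_mul_of_nonneg_left h4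
    (by positivity : 0 ≤ Real.exp (-κ * y) * |F y|)
  refine h6.trans_eq ?_
  linear_combination |F y| * h5

/-- Smooth functions with compact support in `(0, ∞)`. -/
structure IsTest (φ : ℝ → ℝ) : Prop where
  contDiff : ContDiff ℝ ∞ φ
  hasCompactSupport : HasCompactSupport φ
  tsupport_subset : tsupport φ ⊆ Ioi 0

namespace IsTest

variable {φ θ : ℝ → ℝ}

theorem continuous (h : IsTest φ) : Continuous φ := h.contDiff.continuous

theorem hasDerivAt (h : IsTest φ) (x : ℝ) : HasDerivAt φ (deriv φ x) x :=
  (h.contDiff.differentiable (by simp)).differentiableAt.hasDerivAt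

theorem deriv (h : IsTest φ) : IsTest (deriv φ) where
  contDiff := (contDiff_infty_iff_deriv.1 h.contDiff).2
  hasCompactSupport := h.hasCompactSupport.deriv
  tsupport_subset := (closure_minimal (support_deriv_subset) isClosed_closure).trans
    h.tsupport_subset

theorem eq_zero (h : IsTest φ) {x : ℝ} (hx : x ≤ 0) : φ x = 0 :=
  image_eq_zero_of_notMem_tsupport fun hm => (h.tsupport_subset hm).not_ge hx

theorem integrable_mul (h : IsTest φ) {f : ℝ → ℝ} (hf : Continuous f) :
    Integrable fun x => f x * φ x :=
  (hf.mul h.continuous).integrable_of_hasCompactSupport h.hasCompactSupport.mul_left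

theorem add (h : IsTest φ) (h' : IsTest θ) : IsTest (φ + θ) where
  contDiff := h.contDiff.add h'.contDiff
  hasCompactSupport := h.hasCompactSupport.add h'.hasCompactSupport
  tsupport_subset := (tsupport_add φ θ).trans (union_subset h.tsupport_subset h'.tsupport_subset)

theorem smul (h : IsTest φ) (c : ℝ) : IsTest (c • φ) where
  contDiff := contDiff_const.smul h.contDiff
  hasCompactSupport := h.hasCompactSupport.smul_left (f := fun _ => c)
  tsupport_subset := (closure_mono (Function.support_const_smul_subset c φ)).trans
    h.tsupport_subset

theorem integral_mul_deriv (h : IsTest φ) {f f' : ℝ → ℝ} (hf : ∀ x, HasDerivAt f (f' x) x)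
    (hf' : Continuous f') : ∫ x, f x * _root_.deriv φ x = -∫ x, f' x * φ x := by
  have hfc : Continuous f := continuous_iff_continuousAt.2 fun x => (hf x).continuousAt
  exact integral_mul_deriv_eq_deriv_mul_of_integrable (fun x _ => hf x)
    (fun x _ => h.hasDerivAt x) (h.deriv.integrable_mul hfc) (h.integrable_mul hf')
    (h.integrable_mul hfc)

theorem exists_Icc (h : IsTest φ) : ∃ a b, 0 < a ∧ ∀ x, x ∉ Icc a b → φ x = 0 := by
  rcases (tsupport φ).eq_empty_or_nonempty with he | hne
  · exact ⟨1, 1, one_pos, fun x _ => image_eq_zero_of_notMem_tsupport (by simp [he])⟩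
  · have hc : IsCompact (tsupport φ) := h.hasCompactSupport
    obtain ⟨a, ha, ha'⟩ := hc.exists_isLeast hne
    obtain ⟨b, hb, hb'⟩ := hc.exists_isGreatest hne
    exact ⟨a, b, h.tsupport_subset ha, fun x hx =>
      image_eq_zero_of_notMem_tsupport fun hm => hx ⟨ha' hm, hb' hm⟩⟩

theorem of_Icc {a b : ℝ} (ha : 0 < a) (hs : ContDiff ℝ ∞ φ) (h : ∀ x, x ∉ Icc a b → φ x = 0) :
    IsTest φ where
  contDiff := hs
  hasCompactSupport := HasCompactSupport.intro isCompact_Icc h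
  tsupport_subset := (closure_minimal (t := Icc a b) (fun x hx => by_contra fun hn =>
    Function.mem_support.1 hx (h x hn)) isClosed_Icc).trans fun _ hx => ha.trans_le hx.1

/-- `φ + c⁻¹ φ' = θ` is solvable by a test function as soon as `θ` is orthogonal to the
exponential `e^{cx}` annihilated by the adjoint operator. -/
theorem fwd (h : IsTest θ) {c : ℝ} (h0 : ∫ x, Real.exp (c * x) * θ x = 0) :
    IsTest (fwd c θ) := by
  obtain ⟨a, b, ha, hab⟩ := h.exists_Icc
  have hθ := h.continuous
  have hs : ContDiff ℝ ∞ (_root_.fwd c θ) := by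
    have h1 : ContDiff ℝ ∞ fun x => ∫ y in (0 : ℝ)..x, Real.exp (c * y) * θ y := by
      have hd : ∀ x, HasDerivAt (fun x => ∫ y in (0 : ℝ)..x, Real.exp (c * y) * θ y)
          (Real.exp (c * x) * θ x) x := fun x =>
        ((by fun_prop : Continuous fun y => Real.exp (c * y) * θ y).integral_hasStrictDerivAt
          0 x).hasDerivAt
      rw [contDiff_infty_iff_deriv]
      refine ⟨fun x => (hd x).differentiableAt, ?_⟩
      rw [show _root_.deriv _ = _ from funext fun x => (hd x).deriv]
      exact (by fun_prop : ContDiff ℝ ∞ fun x => Real.exp (c * x)).mul h.contDiff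
    exact (by fun_prop : ContDiff ℝ ∞ fun x => c * Real.exp (-c * x)).mul h1
  refine of_Icc (b := b) ha hs fun x hx => ?_
  have hz : ∫ y in (0 : ℝ)..x, Real.exp (c * y) * θ y = 0 := by
    rw [mem_Icc, not_and_or, not_le, not_le] at hx
    rcases hx with hx | hx
    · refine (intervalIntegral.integral_congr (g := fun _ => (0 : ℝ)) fun y hy => ?_).trans (by simp)
      have : θ y = 0 := hab y fun hm => by
        have := hy.2
        have h2 : max 0 x < a := max_lt ha hx
        linarith [hm.1]
      simp [this]
    · refine Eq.trans ?_ h0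
      rcases le_or_gt x 0 with hx0 | hx0
      · have h3 : ∀ y, θ y = 0 := fun y => hab y fun hm => by linarith [hm.1, hm.2]
        simp [h3]
      · rw [intervalIntegral.integral_of_le hx0.le]
        refine setIntegral_eq_integral_of_forall_compl_eq_zero fun y hy => ?_
        have : θ y = 0 := hab y fun hm => hy ⟨ha.trans_le hm.1, hm.2.trans hx.le⟩
        simp [this]
  unfold _root_.fwd
  rw [hz, mul_zero]

/-- `φ - κ⁻² φ'' = θ` is solvable by a test function as soon as `θ` is orthogonal to the two
solutions `e^{±κx}` of the homogeneous equation. -/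
theorem exists_sub_deriv_deriv_eq (h : IsTest θ) {κ : ℝ} (hκ : 0 < κ)
    (h1 : ∫ x, Real.exp (κ * x) * θ x = 0) (h2 : ∫ x, Real.exp (-κ * x) * θ x = 0) :
    ∃ φ, IsTest φ ∧ ∀ x, φ x - (κ ^ 2)⁻¹ * _root_.deriv (_root_.deriv φ) x = θ x := by
  have t1 := h.fwd h1
  set φ₁ := _root_.fwd κ θ
  have d1 : ∀ x, _root_.deriv φ₁ x = κ * (θ x - φ₁ x) := fun x =>
    (hasDerivAt_fwd κ h.continuous x).deriv
  have h3 : ∫ x, Real.exp (-κ * x) * φ₁ x = 0 := by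
    have h4 := t1.integral_mul_deriv (f := fun x => Real.exp (-κ * x))
      (f' := fun x => -κ * Real.exp (-κ * x)) (fun x => by
        refine (((hasDerivAt_id x).const_mul (-κ)).exp).congr_deriv ?_
        simp only [id]; ring) (by fun_prop)
    have i1 := t1.integrable_mul (f := fun x => Real.exp (-κ * x)) (by fun_prop)
    have i2 := h.integrable_mul (f := fun x => Real.exp (-κ * x)) (by fun_prop)
    have e1 : ∫ x, Real.exp (-κ * x) * _root_.deriv φ₁ x
        = κ * ((∫ x, Real.exp (-κ * x) * θ x) - ∫ x, Real.exp (-κ * x) * φ₁ x) := by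
      rw [← integral_sub i2 i1, ← integral_const_mul]
      exact integral_congr_ae (Eventually.of_forall fun x => by simp only [d1]; ring)
    have e2 : ∫ x, -κ * Real.exp (-κ * x) * φ₁ x = -κ * ∫ x, Real.exp (-κ * x) * φ₁ x := by
      rw [← integral_const_mul]
      exact integral_congr_ae (Eventually.of_forall fun x => by simp only; ring)
    rw [e1, e2, h2] at h4
    have : κ * (2 * ∫ x, Real.exp (-κ * x) * φ₁ x) = 0 := by linarith
    simpa [hκ.ne'] using this
  have t2 := t1.fwd h3
  set φ₂ := _root_.fwd (-κ) φ₁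
  have d2 : _root_.deriv φ₂ = fun x => -κ * (φ₁ x - φ₂ x) := funext fun x =>
    (hasDerivAt_fwd (-κ) t1.continuous x).deriv
  refine ⟨φ₂, t2, fun x => ?_⟩
  have d3 : _root_.deriv (_root_.deriv φ₂) x = -κ * (κ * (θ x - φ₁ x) - -κ * (φ₁ x - φ₂ x)) := by
    rw [d2]
    have e1 := t1.hasDerivAt x
    have e2 := t2.hasDerivAt x
    rw [d1] at e1
    rw [d2] at e2
    exact ((e1.sub e2).const_mul (-κ)).deriv
  rw [d3]
  field_simp
  ring

end IsTest

/-- The space of test functions on the open half line. -/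
def testSubmodule : Submodule ℝ (ℝ → ℝ) where
  carrier := {φ | IsTest φ}
  add_mem' h h' := IsTest.add h h'
  zero_mem' := IsTest.of_Icc (a := 1) (b := 1) one_pos contDiff_const fun _ _ => rfl
  smul_mem' c _ h := IsTest.smul h c

/-- The distribution on the half line defined by a continuous function. -/
noncomputable def testPairing {f : ℝ → ℝ} (hf : Continuous f) : testSubmodule →ₗ[ℝ] ℝ where
  toFun φ := ∫ x, f x * (φ : ℝ → ℝ) x
  map_add' φ θ := by
    rw [← integral_add (IsTest.integrable_mul φ.2 hf) (IsTest.integrable_mul θ.2 hf)]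
    exact integral_congr_ae (Eventually.of_forall fun x => by simp [mul_add])
  map_smul' c φ := by
    rw [RingHom.id_apply, smul_eq_mul, ← integral_const_mul]
    exact integral_congr_ae (Eventually.of_forall fun x => by simp [mul_left_comm])

/-- A continuous distributional solution of `Z - κ⁻² Z'' = 0` on `(0, ∞)` is a combination of
`e^{±κx}`: as a functional it vanishes on the common kernel of these two exponentials. -/
theorem exists_eq_exp_of_weak_solution {κ : ℝ} (hκ : 0 < κ) {Z : ℝ → ℝ} (hZ : Continuous Z)
    (h : ∀ φ, IsTest φ → ∫ x, Z x * (φ x - (κ ^ 2)⁻¹ * deriv (deriv φ) x) = 0) :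
    ∃ a b : ℝ, ∀ x, 0 ≤ x → Z x = a * Real.exp (κ * x) + b * Real.exp (-κ * x) := by
  have hc : ∀ i : Fin 2, Continuous fun x => Real.exp ((![κ, -κ] i) * x) := fun i => by fun_prop
  have hmem : testPairing hZ ∈ Submodule.span ℝ (range fun i => testPairing (hc i)) := by
    refine mem_span_of_iInf_ker_le_ker fun θ hθ => ?_
    simp only [Submodule.mem_iInf, LinearMap.mem_ker, Fin.forall_fin_two] at hθ ⊢
    obtain ⟨φ, hφ, heq⟩ := IsTest.exists_sub_deriv_deriv_eq θ.2 hκ hθ.1 hθ.2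
    have := h φ hφ
    simp only [heq] at this
    exact this
  obtain ⟨k, hk⟩ := (Submodule.mem_span_range_iff_exists_fun ℝ).1 hmem
  refine ⟨k 0, k 1, ?_⟩
  set W : ℝ → ℝ := fun x => k 0 * Real.exp (κ * x) + k 1 * Real.exp (-κ * x) with hW
  have hWc : Continuous W := by rw [hW]; fun_prop
  have hae : ∀ᵐ x, x ∈ Ioi (0 : ℝ) → Z x - W x = 0 := by
    refine isOpen_Ioi.ae_eq_zero_of_integral_contDiff_smul_eq_zero
      ((hZ.sub hWc).locallyIntegrable.locallyIntegrableOn _) fun φ h1 h2 h3 => ?_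
    have t : IsTest φ := ⟨h1, h2, h3⟩
    have e := LinearMap.congr_fun hk ⟨φ, t⟩
    simp only [Fin.sum_univ_two, LinearMap.add_apply, LinearMap.smul_apply, smul_eq_mul] at e
    change k 0 * (∫ x, Real.exp (κ * x) * φ x) + k 1 * (∫ x, Real.exp (-κ * x) * φ x)
      = ∫ x, Z x * φ x at e
    have i1 := (t.integrable_mul (hc 0)).const_mul (k 0)
    have i2 := (t.integrable_mul (hc 1)).const_mul (k 1)
    have i3 := t.integrable_mul hZ
    have e2 : ∫ x, W x * φ x =
        k 0 * (∫ x, Real.exp (κ * x) * φ x) + k 1 * (∫ x, Real.exp (-κ * x) * φ x) := by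
      rw [← integral_const_mul, ← integral_const_mul]
      refine Eq.trans ?_ (integral_add i1 i2)
      exact integral_congr_ae (Eventually.of_forall fun x => by simp [hW]; ring)
    have e3 : ∫ x, φ x • (Z x - W x) = (∫ x, Z x * φ x) - ∫ x, W x * φ x := by
      rw [← integral_sub i3 (t.integrable_mul hWc)]
      exact integral_congr_ae (Eventually.of_forall fun x => by simp only [smul_eq_mul]; ring)
    rw [e3, e2, e, sub_self]
  have hae' : Z =ᵐ[volume.restrict (Ioi 0)] W := by
    rw [Filter.EventuallyEq, ae_restrict_iff' measurableSet_Ioi]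
    exact hae.mono fun x hx hx0 => sub_eq_zero.1 (hx hx0)
  have heq := (Measure.eqOn_open_of_ae_eq hae' isOpen_Ioi hZ.continuousOn
    hWc.continuousOn).closure hZ hWc
  rw [closure_Ioi] at heq
  exact fun x hx => heq hx

/-- Boundedness excludes `e^{κx}` and the boundary value excludes `e^{-κx}`. -/
theorem eq_zero_of_weak_solution {κ C : ℝ} (hκ : 0 < κ) {Z : ℝ → ℝ} (hZ : Continuous Z)
    (hC : ∀ x, 0 ≤ x → |Z x| ≤ C) (h0 : Z 0 = 0)
    (h : ∀ φ, IsTest φ → ∫ x, Z x * (φ x - (κ ^ 2)⁻¹ * deriv (deriv φ) x) = 0) {x : ℝ}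
    (hx : 0 ≤ x) : Z x = 0 := by
  obtain ⟨a, b, hab⟩ := exists_eq_exp_of_weak_solution hκ hZ h
  have hb := hab 0 le_rfl
  rw [h0, mul_zero, mul_zero, Real.exp_zero] at hb
  have ha : a = 0 := by
    by_contra hne
    have ht : Tendsto (fun x => |a| * Real.exp (κ * x)) atTop atTop :=
      (Real.tendsto_exp_atTop.comp (tendsto_id.const_mul_atTop hκ)).const_mul_atTop
        (abs_pos.2 hne)
    obtain ⟨y, hy, hy0⟩ := ((ht.eventually_gt_atTop (C + |b|)).and (eventually_ge_atTop 0)).exists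
    have e1 : a * Real.exp (κ * y) = Z y - b * Real.exp (-κ * y) := by rw [hab y hy0]; ring
    have e2 : |a| * Real.exp (κ * y) ≤ C + |b| * 1 := by
      rw [← Real.abs_exp (κ * y), ← abs_mul, e1]
      refine (abs_sub _ _).trans (add_le_add (hC y hy0) ?_)
      rw [abs_mul, Real.abs_exp]
      refine mul_le_mul_of_nonneg_left (Real.exp_le_one_iff.2 ?_) (abs_nonneg b)
      nlinarith
    linarith
  have hb0 : b = 0 := by linarith
  rw [hab x hx, ha, hb0]
  ring

/-! ### The elliptic boundary value problem -/

/-- The adjoint of `1 + κ⁻¹∂`, applied to `φ + κ⁻¹ φ'`, is `φ - κ⁻² φ''`; hence `fwd κ` drops out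
against such test functions. -/
theorem integral_fwd_mul_test {κ : ℝ} (hκ : 0 < κ) {p φ : ℝ → ℝ} (hp : Continuous p)
    (hφ : IsTest φ) : ∫ x, fwd κ p x * (φ x - (κ ^ 2)⁻¹ * deriv (deriv φ) x) =
      ∫ x, p x * (φ x + κ⁻¹ * deriv φ x) := by
  have hc := continuous_fwd κ hp
  have hd := hasDerivAt_fwd κ hp
  have hc' : Continuous fun x => κ * (p x - fwd κ p x) := by fun_prop
  have h1 := hφ.deriv.integral_mul_deriv hd hc'
  have h2 := hφ.integral_mul_deriv hd hc'
  have i1 := hφ.integrable_mul hc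
  have i2 := hφ.deriv.integrable_mul hc
  have i3 := hφ.deriv.deriv.integrable_mul hc
  have j1 := hφ.integrable_mul hp
  have j2 := hφ.deriv.integrable_mul hp
  have e1 : ∫ x, κ * (p x - fwd κ p x) * deriv φ x
      = κ * ((∫ x, p x * deriv φ x) - ∫ x, fwd κ p x * deriv φ x) := by
    rw [← integral_sub j2 i2, ← integral_const_mul]
    exact integral_congr_ae (Eventually.of_forall fun x => by simp only; ring)
  have e2 : ∫ x, κ * (p x - fwd κ p x) * φ x
      = κ * ((∫ x, p x * φ x) - ∫ x, fwd κ p x * φ x) := by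
    rw [← integral_sub j1 i1, ← integral_const_mul]
    exact integral_congr_ae (Eventually.of_forall fun x => by simp only; ring)
  have e3 : ∫ x, fwd κ p x * (φ x - (κ ^ 2)⁻¹ * deriv (deriv φ) x)
      = (∫ x, fwd κ p x * φ x) - (κ ^ 2)⁻¹ * ∫ x, fwd κ p x * deriv (deriv φ) x := by
    rw [← integral_const_mul, ← integral_sub i1 (i3.const_mul _)]
    exact integral_congr_ae (Eventually.of_forall fun x => by simp only; ring)
  have e4 : ∫ x, p x * (φ x + κ⁻¹ * deriv φ x)
      = (∫ x, p x * φ x) + κ⁻¹ * ∫ x, p x * deriv φ x := by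
    rw [← integral_const_mul, ← integral_add j1 (j2.const_mul _)]
    exact integral_congr_ae (Eventually.of_forall fun x => by simp only; ring)
  rw [e1] at h1
  rw [e2] at h2
  rw [e3, e4, h1]
  field_simp
  linear_combination -h2

theorem integral_bwd_mul_test {κ C : ℝ} (hκ : 0 < κ) {p φ : ℝ → ℝ} (hp : Continuous p)
    (hC : ∀ y, 0 ≤ y → |p y| ≤ C) (hφ : IsTest φ) :
    ∫ x, bwd κ p x * (φ x + κ⁻¹ * deriv φ x) = ∫ x, p x * φ x := by
  have hc := continuous_bwd hκ hp hC
  have hd := hasDerivAt_bwd hκ hp hC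
  have h2 := hφ.integral_mul_deriv hd (by fun_prop)
  have i1 := hφ.integrable_mul hc
  have i2 := hφ.deriv.integrable_mul hc
  have j1 := hφ.integrable_mul hp
  have e2 : ∫ x, κ * (bwd κ p x - p x) * φ x
      = κ * ((∫ x, bwd κ p x * φ x) - ∫ x, p x * φ x) := by
    rw [← integral_sub i1 j1, ← integral_const_mul]
    exact integral_congr_ae (Eventually.of_forall fun x => by simp only; ring)
  have e4 : ∫ x, bwd κ p x * (φ x + κ⁻¹ * deriv φ x)
      = (∫ x, bwd κ p x * φ x) + κ⁻¹ * ∫ x, bwd κ p x * deriv φ x := by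
    rw [← integral_const_mul, ← integral_add i1 (i2.const_mul _)]
    exact integral_congr_ae (Eventually.of_forall fun x => by simp only; ring)
  rw [e2] at h2
  rw [e4, h2]
  field_simp
  ring

theorem integral_bwd_mul_test_of_integrable {κ : ℝ} (hκ : 0 < κ) {F φ : ℝ → ℝ}
    (hF : Integrable F) (h0 : ∀ y, y < 0 → F y = 0) (hφ : IsTest φ) :
    ∫ x, bwd κ F x * (φ x + κ⁻¹ * deriv φ x) = ∫ x, F x * φ x := by
  have hφ' := hφ.deriv.continuous
  have hφc := hφ.continuous
  have ha : Integrable fun x => κ * Real.exp (κ * x) * (φ x + κ⁻¹ * deriv φ x) := by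
    refine ((hφ.integrable_mul (f := fun x => κ * Real.exp (κ * x)) (by fun_prop)).add
      (hφ.deriv.integrable_mul (f := fun x => κ * Real.exp (κ * x) * κ⁻¹) (by fun_prop))).congr
      (Eventually.of_forall fun x => ?_)
    simp only [Pi.add_apply]; ring
  have hb := integrable_exp_neg_mul_of_eq_zero hκ hF h0
  have hd : ∀ x, HasDerivAt (fun x => Real.exp (κ * x) * φ x)
      (κ * Real.exp (κ * x) * (φ x + κ⁻¹ * deriv φ x)) x := fun x => by
    refine ((((hasDerivAt_id x).const_mul κ).exp).mul (hφ.hasDerivAt x)).congr_deriv ?_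
    simp only [id]
    field_simp
  have hI : ∀ y, ∫ x in Iio y, κ * Real.exp (κ * x) * (φ x + κ⁻¹ * deriv φ x)
      = Real.exp (κ * y) * φ y := fun y => by
    have ht : Tendsto (fun x => Real.exp (κ * x) * φ x) atBot (𝓝 0) :=
      tendsto_const_nhds.congr' ((eventually_le_atBot 0).mono fun x hx => by
        simp only [hφ.eq_zero hx, mul_zero])
    rw [← integral_Iic_eq_integral_Iio,
      integral_Iic_of_hasDerivAt_of_tendsto' (fun x _ => hd x) ha.integrableOn ht, sub_zero]
  have h := integral_mul_integral_Ioi_eq ha hb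
  simp only [hI] at h
  refine Eq.trans ?_ (h.trans ?_)
  · refine integral_congr_ae (Eventually.of_forall fun x => ?_)
    simp only [bwd]; ring
  · refine integral_congr_ae (Eventually.of_forall fun y => ?_)
    have h3 : Real.exp (-κ * y) * Real.exp (κ * y) = 1 := by rw [← Real.exp_add]; simp
    simp only
    linear_combination (F y * φ y) * h3

/-- The bounded solution of `D - κ⁻² D'' = -α U' + F`, `D(0) = 0`, on the half line: factoring
`1 - κ⁻²∂² = (1 + κ⁻¹∂)(1 - κ⁻¹∂)` gives `D = fwd (α κ (U - bwd U) + bwd F)`. -/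
theorem eq_fwd_of_weak_equation {κ α B C : ℝ} (hκ : 0 < κ) {D U F : ℝ → ℝ} (hD : Continuous D)
    (hC : ∀ x, 0 ≤ x → |D x| ≤ C) (hD0 : D 0 = 0) (hU : Continuous U)
    (hB : ∀ x, 0 ≤ x → |U x| ≤ B) (hF : Integrable F) (hF0 : ∀ y, y < 0 → F y = 0)
    (h : ∀ φ, IsTest φ → ∫ x, D x * (φ x - (κ ^ 2)⁻¹ * deriv (deriv φ) x) =
      α * (∫ x, U x * deriv φ x) + ∫ x, F x * φ x) {x : ℝ} (hx : 0 ≤ x) :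
    D x = fwd κ (fun y => α * κ * (U y - bwd κ U y) + bwd κ F y) x := by
  have cB := continuous_bwd hκ hU hB
  have cF := continuous_bwd_of_integrable hκ hF hF0
  set η : ℝ → ℝ := fun y => α * κ * (U y - bwd κ U y) + bwd κ F y with hη
  have cη : Continuous η := by fun_prop
  have hηb : ∀ y, 0 ≤ y → |η y| ≤ |α * κ| * (B + B) + κ * ∫ y, |F y| := fun y hy => by
    refine (abs_add_le _ _).trans (add_le_add ?_ (abs_bwd_le_of_integrable hκ hF y))
    rw [abs_mul]
    exact mul_le_mul_of_nonneg_left ((abs_sub _ _).trans (add_le_add (hB y hy)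
      (abs_bwd_le hκ fun z hz => hB z (hy.trans hz)))) (abs_nonneg _)
  have cfwd := continuous_fwd κ cη
  refine sub_eq_zero.1 (eq_zero_of_weak_solution (Z := fun x => D x - fwd κ η x)
    (C := C + (|α * κ| * (B + B) + κ * ∫ y, |F y|)) hκ (hD.sub cfwd)
    (fun y hy => (abs_sub _ _).trans (add_le_add (hC y hy)
      (abs_fwd_le hκ hy fun z hz _ => hηb z hz)))
    (by simp only [hD0, fwd_zero_right, sub_zero]) (fun φ hφ => ?_) hx)
  have i1 := hφ.integrable_mul hU
  have i2 := hφ.deriv.integrable_mul hU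
  have i3 : Integrable fun x => bwd κ U x * (φ x + κ⁻¹ * deriv φ x) :=
    ((hφ.integrable_mul cB).add ((hφ.deriv.integrable_mul cB).const_mul κ⁻¹)).congr
      (Eventually.of_forall fun x => by simp only [Pi.add_apply]; ring)
  have i4 : Integrable fun x => bwd κ F x * (φ x + κ⁻¹ * deriv φ x) :=
    ((hφ.integrable_mul cF).add ((hφ.deriv.integrable_mul cF).const_mul κ⁻¹)).congr
      (Eventually.of_forall fun x => by simp only [Pi.add_apply]; ring)
  have i5 : ∀ {f : ℝ → ℝ}, Continuous f →
      Integrable fun x => f x * (φ x - (κ ^ 2)⁻¹ * deriv (deriv φ) x) := fun {f} hf =>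
    ((hφ.integrable_mul hf).sub ((hφ.deriv.deriv.integrable_mul hf).const_mul (κ ^ 2)⁻¹)).congr
      (Eventually.of_forall fun x => by simp only [Pi.sub_apply]; ring)
  have e1 : ∫ x, η x * (φ x + κ⁻¹ * deriv φ x) = α * κ * (((∫ x, U x * φ x)
      + κ⁻¹ * ∫ x, U x * deriv φ x) - ∫ x, bwd κ U x * (φ x + κ⁻¹ * deriv φ x))
      + ∫ x, bwd κ F x * (φ x + κ⁻¹ * deriv φ x) := by
    have i12 : Integrable fun x => U x * φ x + κ⁻¹ * (U x * deriv φ x) :=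
      i1.add (i2.const_mul κ⁻¹)
    have i123 : Integrable fun x => α * κ * (U x * φ x + κ⁻¹ * (U x * deriv φ x)
      - bwd κ U x * (φ x + κ⁻¹ * deriv φ x)) := (i12.sub i3).const_mul _
    rw [← integral_const_mul κ⁻¹, ← integral_add i1 (i2.const_mul κ⁻¹), ← integral_sub i12 i3,
      ← integral_const_mul, ← integral_add i123 i4]
    exact integral_congr_ae (Eventually.of_forall fun x => by simp only [hη]; ring)
  have e2 : ∫ x, (D x - fwd κ η x) * (φ x - (κ ^ 2)⁻¹ * deriv (deriv φ) x)
      = (∫ x, D x * (φ x - (κ ^ 2)⁻¹ * deriv (deriv φ) x))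
        - ∫ x, fwd κ η x * (φ x - (κ ^ 2)⁻¹ * deriv (deriv φ) x) := by
    rw [← integral_sub (i5 hD) (i5 cfwd)]
    exact integral_congr_ae (Eventually.of_forall fun x => by simp only; ring)
  rw [e2, h φ hφ, integral_fwd_mul_test hκ cη hφ, e1, integral_bwd_mul_test hκ hU hB hφ,
    integral_bwd_mul_test_of_integrable hκ hF hF0 hφ]
  field_simp
  ring

/-- A function on the closed quarter plane, extended to the plane by its values at the
nearest point. -/
def quarterExt (u : ℝ → ℝ → ℝ) (x t : ℝ) : ℝ := u (max x 0) (max t 0)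

theorem quarterExt_eq (u : ℝ → ℝ → ℝ) {x t : ℝ} (hx : 0 ≤ x) (ht : 0 ≤ t) :
    quarterExt u x t = u x t := by simp [quarterExt, hx, ht]

/-- An `L¹` function on the half line, extended by zero. -/
noncomputable def zeroExt (F : L1HalfLine) : ℝ → ℝ := (Ici (0 : ℝ)).indicator F

theorem integrable_zeroExt (F : L1HalfLine) : Integrable (zeroExt F) :=
  (integrable_indicator_iff measurableSet_Ici).2 (L1.integrable_coeFn F)

theorem zeroExt_of_neg (F : L1HalfLine) {y : ℝ} (hy : y < 0) : zeroExt F y = 0 :=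
  indicator_of_notMem (by simpa using hy) _

theorem integral_zeroExt_mul (F : L1HalfLine) (φ : ℝ → ℝ) :
    ∫ x, zeroExt F x * φ x = ∫ x in Ici (0 : ℝ), F x * φ x := by
  rw [← integral_indicator measurableSet_Ici]
  refine integral_congr_ae (Eventually.of_forall fun x => ?_)
  simp only [zeroExt, indicator]
  split_ifs <;> simp

theorem integral_abs_zeroExt (F : L1HalfLine) : ∫ x, |zeroExt F x| = ‖F‖ := by
  rw [L1.norm_eq_integral_norm, ← integral_indicator measurableSet_Ici]
  refine integral_congr_ae (Eventually.of_forall fun x => ?_)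
  simp only [zeroExt, indicator, Real.norm_eq_abs]
  split_ifs <;> simp

namespace IsTest

variable {φ : ℝ → ℝ}

theorem setIntegral_Ici_mul (h : IsTest φ) (f : ℝ → ℝ) :
    ∫ x in Ici (0 : ℝ), f x * φ x = ∫ x, f x * φ x :=
  setIntegral_eq_integral_of_forall_compl_eq_zero fun x hx => by
    rw [h.eq_zero (le_of_lt (not_le.1 hx)), mul_zero]

theorem exists_integral_eq (h : IsTest φ) :
    ∃ b : ℝ, ∀ f : ℝ → ℝ, ∫ x, f x * φ x = ∫ x in (0 : ℝ)..b, f x * φ x := by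
  obtain ⟨a, b, ha, hab⟩ := h.exists_Icc
  refine ⟨b, fun f => (intervalIntegral.integral_eq_integral_of_support_subset fun x hx => ?_).symm⟩
  have : x ∈ Icc a b := by
    by_contra hn
    exact hx (by simp only [hab x hn, mul_zero])
  exact ⟨ha.trans_le this.1, this.2⟩

/-- Pairing with a test function, as a continuous functional on `L¹`. -/
noncomputable def pairingL1 (h : IsTest φ) : L1HalfLine →L[ℝ] ℝ :=
  have hb := h.continuous.bounded_above_of_compact_support h.hasCompactSupport
  have hi : ∀ F : L1HalfLine, IntegrableOn (fun x => F x * φ x) (Ici 0) := fun F =>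
    (L1.integrable_coeFn F).mul_bdd h.continuous.aestronglyMeasurable
      (Eventually.of_forall hb.choose_spec)
  LinearMap.mkContinuous
    { toFun := fun F => ∫ x in Ici (0 : ℝ), F x * φ x
      map_add' := fun F G => by
        rw [← integral_add (hi F) (hi G)]
        refine integral_congr_ae ((Lp.coeFn_add F G).mono fun x hx => ?_)
        simp only [hx, Pi.add_apply, add_mul]
      map_smul' := fun c F => by
        rw [RingHom.id_apply, smul_eq_mul, ← integral_const_mul]
        refine integral_congr_ae ((Lp.coeFn_smul c F).mono fun x hx => ?_)
        simp only [hx, Pi.smul_apply, smul_eq_mul, mul_assoc] }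
    hb.choose fun F => by
      refine (norm_integral_le_of_norm_le ((L1.integrable_coeFn F).norm.const_mul hb.choose)
        (Eventually.of_forall fun x => ?_)).trans_eq ?_
      · rw [norm_mul, mul_comm]
        exact mul_le_mul_of_nonneg_right (hb.choose_spec x) (norm_nonneg _)
      · rw [integral_const_mul, L1.norm_eq_integral_norm]

theorem pairingL1_apply (h : IsTest φ) (F : L1HalfLine) :
    h.pairingL1 F = ∫ x in Ici (0 : ℝ), F x * φ x := rfl

end IsTest

/-! ### The mild form and the time difference over one period -/

namespace IsLinearBBMSolution

variable {α γ κ : ℝ} {f : ℝ → L1HalfLine} {u₀ g : ℝ → ℝ} {u : ℝ → ℝ → ℝ}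

theorem continuous_quarterExt (hu : IsLinearBBMSolution α γ f u₀ g u) :
    Continuous fun z : ℝ × ℝ => quarterExt u z.1 z.2 :=
  hu.continuousOn.comp_continuous (f := fun z : ℝ × ℝ => (max z.1 0, max z.2 0)) (by fun_prop)
    fun z => ⟨mem_Ici.2 (le_max_right _ _), mem_Ici.2 (le_max_right _ _)⟩

theorem bounded_quarterExt (hu : IsLinearBBMSolution α γ f u₀ g u) :
    BoundedUpToTime (quarterExt u) := fun T => by
  obtain ⟨C, hC⟩ := hu.bounded (max T 0)
  exact ⟨C, fun x _ t ht => hC _ (mem_Ici.2 (le_max_right _ _)) _ ⟨le_max_right _ _, max_le_max_right 0 ht⟩⟩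

/-- The equation integrated over the time interval `[a, b]`. -/
theorem integrated_equation (hu : IsLinearBBMSolution α γ f u₀ g u) (hf : ContinuousOn f (Ici 0))
    {a b : ℝ} (ha : 0 ≤ a) (hab : a ≤ b) {φ : ℝ → ℝ} (hφ : IsTest φ) :
    (∫ x, quarterExt u x b * (φ x - γ * deriv (deriv φ) x))
      - ∫ x, quarterExt u x a * (φ x - γ * deriv (deriv φ) x) =
    α * (∫ x, (∫ s in a..b, quarterExt u x s) * deriv φ x)
      + ∫ x, zeroExt (∫ s in a..b, f s) x * φ x := by
  have hθ : IsTest fun x => φ x - γ * deriv (deriv φ) x := by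
    have := hφ.add (hφ.deriv.deriv.smul (-γ))
    convert this using 1
    funext x
    simp only [Pi.add_apply, Pi.smul_apply, smul_eq_mul]
    ring
  have hder : ∀ t, 0 ≤ t → HasDerivWithinAt
      (fun s => ∫ x in Ici (0 : ℝ), u x s * (φ x - γ * deriv (deriv φ) x))
      (α * (∫ x, quarterExt u x t * deriv φ x) + hφ.pairingL1 (f t)) (Ici 0) t := fun t ht => by
    have h1 := hu.equation φ hφ.contDiff hφ.hasCompactSupport hφ.tsupport_subset t ht
    have h2 : iteratedDeriv 2 φ = deriv (deriv φ) := by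
      rw [iteratedDeriv_succ, iteratedDeriv_one]
    rw [h2] at h1
    have h3 : ∫ x, quarterExt u x t * deriv φ x = ∫ x in Ici (0 : ℝ), u x t * deriv φ x := by
      rw [← hφ.deriv.setIntegral_Ici_mul]
      exact setIntegral_congr_fun measurableSet_Ici fun x hx => by
        simp only [quarterExt_eq u hx ht]
    rwa [h3, IsTest.pairingL1_apply]
  obtain ⟨B, hB⟩ := hφ.deriv.exists_integral_eq
  have c1 : Continuous fun t => ∫ x, quarterExt u x t * deriv φ x := by
    simp only [hB]
    refine intervalIntegral.continuous_parametric_intervalIntegral_of_continuous' ?_ _ _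
    have h1 := hu.continuous_quarterExt.comp (f := fun z : ℝ × ℝ => (z.2, z.1)) (by fun_prop)
    exact h1.mul (hφ.deriv.continuous.comp continuous_snd)
  have hIcc : uIcc a b ⊆ Ici 0 := fun s hs => by
    rw [uIcc_of_le hab] at hs; exact ha.trans hs.1
  have c2 : ContinuousOn (fun t => hφ.pairingL1 (f t)) (uIcc a b) :=
    hφ.pairingL1.continuous.comp_continuousOn (hf.mono hIcc)
  have i1 : IntervalIntegrable (fun t => α * ∫ x, quarterExt u x t * deriv φ x) volume a b :=
    (continuous_const.mul c1).intervalIntegrable _ _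
  have i2 : IntervalIntegrable (fun t => hφ.pairingL1 (f t)) volume a b := c2.intervalIntegrable
  have hFTC := intervalIntegral.integral_eq_sub_of_hasDeriv_right_of_le hab
    (fun t ht => (hder t (ha.trans ht.1)).continuousWithinAt.mono
      fun s hs => ha.trans hs.1)
    (fun t ht => (hder t (ha.trans ht.1.le)).mono fun s hs =>
      (ha.trans ht.1.le).trans (le_of_lt hs)) (i1.add i2)
  rw [intervalIntegral.integral_add i1 i2, intervalIntegral.integral_const_mul,
    hφ.pairingL1.intervalIntegral_comp_comm (hf.mono hIcc).intervalIntegrable] at hFTC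
  have hend : ∀ t, 0 ≤ t → ∫ x in Ici (0 : ℝ), u x t * (φ x - γ * deriv (deriv φ) x)
      = ∫ x, quarterExt u x t * (φ x - γ * deriv (deriv φ) x) := fun t ht => by
    rw [← hθ.setIntegral_Ici_mul]
    exact setIntegral_congr_fun measurableSet_Ici fun x hx => by
      simp only [quarterExt_eq u hx ht]
  have hswap : ∫ x, (∫ s in a..b, quarterExt u x s) * deriv φ x
      = ∫ t in a..b, ∫ x, quarterExt u x t * deriv φ x := by
    rw [hB fun x => ∫ s in a..b, quarterExt u x s]
    simp only [hB, ← intervalIntegral.integral_mul_const]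
    exact intervalIntegral_swap_of_continuous (F := fun x s => quarterExt u x s * deriv φ x)
      (hu.continuous_quarterExt.mul (hφ.deriv.continuous.comp continuous_fst)) _ _ _ _
  rw [hend b (ha.trans hab), hend a ha, IsTest.pairingL1_apply, ← hswap,
    ← integral_zeroExt_mul] at hFTC
  exact hFTC.symm

theorem abs_integral_quarterExt_le {C T : ℝ}
    (hC : ∀ x, 0 ≤ x → ∀ t, t ≤ T → |quarterExt u x t| ≤ C) {a b : ℝ} (hab : a ≤ b) (hb : b ≤ T)
    {x : ℝ} (hx : 0 ≤ x) : |∫ s in a..b, quarterExt u x s| ≤ C * (b - a) := by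
  rw [← abs_of_nonneg (sub_nonneg.2 hab), ← Real.norm_eq_abs]
  refine intervalIntegral.norm_integral_le_of_norm_le_const fun s hs => ?_
  rw [uIoc_of_le hab] at hs
  exact hC x hx s (hs.2.trans hb)

theorem continuous_integral_quarterExt (hu : IsLinearBBMSolution α γ f u₀ g u) (a b : ℝ) :
    Continuous fun x => ∫ s in a..b, quarterExt u x s :=
  intervalIntegral.continuous_parametric_intervalIntegral_of_continuous'
    hu.continuous_quarterExt a b

/-- The mild form of the equation on the time interval `[a, b]`. -/
theorem mild (hu : IsLinearBBMSolution α γ f u₀ g u) (hf : ContinuousOn f (Ici 0)) (hκ : 0 < κ)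
    (hγ : (κ ^ 2)⁻¹ = γ) {a b : ℝ} (ha : 0 ≤ a) (hab : a ≤ b) {x : ℝ} (hx : 0 ≤ x) :
    u x b - u x a = (g b - g a) * Real.exp (-κ * x) +
      fwd κ (fun y => α * κ * ((∫ s in a..b, quarterExt u y s)
        - bwd κ (fun z => ∫ s in a..b, quarterExt u z s) y)
        + bwd κ (zeroExt (∫ s in a..b, f s)) y) x := by
  obtain ⟨C, hC⟩ := hu.bounded_quarterExt b
  set D : ℝ → ℝ := fun x => quarterExt u x b - quarterExt u x a
    - (g b - g a) * Real.exp (-κ * x) with hD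
  have cb := continuous_slice_left hu.continuous_quarterExt b
  have ca := continuous_slice_left hu.continuous_quarterExt a
  have cD : Continuous D := by rw [hD]; fun_prop
  have hDC : ∀ x, 0 ≤ x → |D x| ≤ C + C + |g b - g a| * 1 := fun y hy => by
    refine (abs_sub _ _).trans (add_le_add ((abs_sub _ _).trans (add_le_add
      (hC y hy b le_rfl) (hC y hy a hab))) ?_)
    rw [abs_mul, Real.abs_exp]
    exact mul_le_mul_of_nonneg_left (Real.exp_le_one_iff.2 (by nlinarith)) (abs_nonneg _)
  have hD0 : D 0 = 0 := by
    simp only [hD, quarterExt_eq u le_rfl (ha.trans hab), quarterExt_eq u le_rfl ha,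
      hu.boundary b (ha.trans hab), hu.boundary a ha, mul_zero, Real.exp_zero, mul_one, sub_self]
  have h := eq_fwd_of_weak_equation (α := α) hκ cD hDC hD0
    (hu.continuous_integral_quarterExt a b)
    (fun y hy => abs_integral_quarterExt_le hC hab le_rfl hy) (integrable_zeroExt (∫ s in a..b, f s))
    (fun y hy => zeroExt_of_neg _ hy) (fun φ hφ => ?_) hx
  · rw [← h]
    simp only [hD, quarterExt_eq u hx (ha.trans hab), quarterExt_eq u hx ha]
    ring
  · have h1 := hu.integrated_equation hf ha hab hφ
    rw [← h1, ← hγ]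
    have cE : Continuous fun x => Real.exp (-κ * x) := by fun_prop
    have i5 : ∀ {p : ℝ → ℝ}, Continuous p →
        Integrable fun x => p x * (φ x - (κ ^ 2)⁻¹ * deriv (deriv φ) x) := fun {p} hp =>
      ((hφ.integrable_mul hp).sub ((hφ.deriv.deriv.integrable_mul hp).const_mul (κ ^ 2)⁻¹)).congr
        (Eventually.of_forall fun x => by simp only [Pi.sub_apply]; ring)
    have hdE : ∀ x, HasDerivAt (fun x => Real.exp (-κ * x)) (-κ * Real.exp (-κ * x)) x := fun x => by
      refine (((hasDerivAt_id x).const_mul (-κ)).exp).congr_deriv ?_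
      simp only [id]; ring
    have hE : ∫ x, Real.exp (-κ * x) * (φ x - (κ ^ 2)⁻¹ * deriv (deriv φ) x) = 0 := by
      have e1 := hφ.deriv.integral_mul_deriv hdE (by fun_prop)
      have e2 := hφ.integral_mul_deriv hdE (by fun_prop)
      simp only [mul_assoc, integral_const_mul] at e1 e2
      rw [e2] at e1
      have e3 : ∫ x, Real.exp (-κ * x) * (φ x - (κ ^ 2)⁻¹ * deriv (deriv φ) x)
          = (∫ x, Real.exp (-κ * x) * φ x)
            - (κ ^ 2)⁻¹ * ∫ x, Real.exp (-κ * x) * deriv (deriv φ) x := by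
        rw [← integral_const_mul, ← integral_sub (hφ.integrable_mul cE)
          ((hφ.deriv.deriv.integrable_mul cE).const_mul _)]
        exact integral_congr_ae (Eventually.of_forall fun x => by simp only; ring)
      rw [e3, e1]
      field_simp
      ring
    have e4 : ∫ x, D x * (φ x - (κ ^ 2)⁻¹ * deriv (deriv φ) x)
        = (∫ x, quarterExt u x b * (φ x - (κ ^ 2)⁻¹ * deriv (deriv φ) x))
          - (∫ x, quarterExt u x a * (φ x - (κ ^ 2)⁻¹ * deriv (deriv φ) x))
          - (g b - g a) * ∫ x, Real.exp (-κ * x) * (φ x - (κ ^ 2)⁻¹ * deriv (deriv φ) x) := by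
      have i1 : Integrable fun x => quarterExt u x b * (φ x - (κ ^ 2)⁻¹ * deriv (deriv φ) x)
          - quarterExt u x a * (φ x - (κ ^ 2)⁻¹ * deriv (deriv φ) x) := (i5 cb).sub (i5 ca)
      rw [← integral_const_mul, ← integral_sub (i5 cb) (i5 ca),
        ← integral_sub i1 ((i5 cE).const_mul _)]
      exact integral_congr_ae (Eventually.of_forall fun x => by simp only [hD]; ring)
    rw [e4, hE, mul_zero, sub_zero]

end IsLinearBBMSolution

theorem intervalIntegral_add_period {E : Type*} [NormedAddCommGroup E] [NormedSpace ℝ E]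
    {f : ℝ → E} {T₀ : ℝ} (hT₀ : 0 ≤ T₀) (hf : ContinuousOn f (Ici 0))
    (hper : ∀ t ∈ Ici (0 : ℝ), f (t + T₀) = f t) {t : ℝ} (ht : 0 ≤ t) :
    ∫ s in t..(t + T₀), f s = ∫ s in (0 : ℝ)..T₀, f s := by
  have hi : ∀ a b, 0 ≤ a → 0 ≤ b → IntervalIntegrable f volume a b := fun a b ha hb =>
    (hf.mono fun s hs => (le_min ha hb).trans hs.1).intervalIntegrable
  have h1 : ∫ s in T₀..(t + T₀), f s = ∫ s in (0 : ℝ)..t, f s := by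
    have := intervalIntegral.integral_comp_add_right (a := 0) (b := t) f T₀
    rw [zero_add] at this
    rw [← this]
    refine intervalIntegral.integral_congr fun s hs => ?_
    rw [uIcc_of_le ht] at hs
    exact hper s hs.1
  have h2 := intervalIntegral.integral_add_adjacent_intervals (hi 0 t le_rfl ht)
    (hi t (t + T₀) ht (by positivity))
  have h3 := intervalIntegral.integral_add_adjacent_intervals (hi 0 T₀ le_rfl hT₀)
    (hi T₀ (t + T₀) hT₀ (by positivity))
  rw [← h3, h1, add_comm] at h2
  exact add_right_cancel h2

/-- The reduced unknown `h = w + κ⁻¹ w_x` of the time difference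
`w(x, t) = u(x, t + T₀) - u(x, t)`, read off from the mild form; `F` is the integral of the forcing
over one period. -/
noncomputable def periodReduced (α κ T₀ : ℝ) (F : L1HalfLine) (u : ℝ → ℝ → ℝ) (x t : ℝ) : ℝ :=
  α * κ * ((∫ s in t..(t + T₀), quarterExt u x s)
    - bwd κ (fun z => ∫ s in t..(t + T₀), quarterExt u z s) x) + bwd κ (zeroExt F) x

namespace IsLinearBBMSolution

variable {α γ κ T₀ : ℝ} {f : ℝ → L1HalfLine} {u₀ g : ℝ → ℝ} {u : ℝ → ℝ → ℝ}

theorem flowW_periodReduced (hu : IsLinearBBMSolution α γ f u₀ g u) (hf : ContinuousOn f (Ici 0))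
    (hκ : 0 < κ) (hγ : (κ ^ 2)⁻¹ = γ) (hT₀ : 0 < T₀)
    (hgper : ∀ t ∈ Ici (0 : ℝ), g (t + T₀) = g t) (hfper : ∀ t ∈ Ici (0 : ℝ), f (t + T₀) = f t)
    {x t : ℝ} (hx : 0 ≤ x) (ht : 0 ≤ t) :
    flowW κ (periodReduced α κ T₀ (∫ s in (0 : ℝ)..T₀, f s) u) x t = u x (t + T₀) - u x t := by
  rw [hu.mild hf hκ hγ ht (by linarith : t ≤ t + T₀) hx, hgper t ht, sub_self, zero_mul, zero_add,
    intervalIntegral_add_period hT₀.le hf hfper ht]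
  rfl

/-- Differentiating the mild form in time: `∂_t ∫_t^{t+T₀} u = w`, and the forcing term is constant. -/
theorem isReducedFlow_periodReduced (hu : IsLinearBBMSolution α γ f u₀ g u)
    (hf : ContinuousOn f (Ici 0)) (hκ : 0 < κ) (hγ : (κ ^ 2)⁻¹ = γ) (hT₀ : 0 < T₀)
    (hgper : ∀ t ∈ Ici (0 : ℝ), g (t + T₀) = g t) (hfper : ∀ t ∈ Ici (0 : ℝ), f (t + T₀) = f t) :
    IsReducedFlow κ (α * κ) (periodReduced α κ T₀ (∫ s in (0 : ℝ)..T₀, f s) u) := by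
  set F := ∫ s in (0 : ℝ)..T₀, f s with hF
  have cu := hu.continuous_quarterExt
  have hprim : ∀ x t, ∫ s in t..(t + T₀), quarterExt u x s
      = (∫ s in (0 : ℝ)..(t + T₀), quarterExt u x s) - ∫ s in (0 : ℝ)..t, quarterExt u x s :=
    fun x t => (intervalIntegral.integral_interval_sub_left
      ((continuous_slice_right cu x).intervalIntegrable _ _)
      ((continuous_slice_right cu x).intervalIntegrable _ _)).symm
  have cU : Continuous fun z : ℝ × ℝ => ∫ s in z.2..(z.2 + T₀), quarterExt u z.1 s := by
    simp only [hprim]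
    have h1 : Continuous (Function.uncurry fun (z : ℝ × ℝ) (s : ℝ) => quarterExt u z.1 s) :=
      cu.comp (f := fun a : (ℝ × ℝ) × ℝ => (a.1.1, a.2)) (by fun_prop)
    exact (intervalIntegral.continuous_parametric_intervalIntegral_of_continuous (μ := volume)
      (a₀ := 0) (s := fun z : ℝ × ℝ => z.2 + T₀) h1 (by fun_prop)).sub
      (intervalIntegral.continuous_parametric_intervalIntegral_of_continuous (μ := volume)
      (a₀ := 0) (s := fun z : ℝ × ℝ => z.2) h1 (by fun_prop))
  have bU : BoundedUpToTime fun x t => ∫ s in t..(t + T₀), quarterExt u x s := fun T => by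
    obtain ⟨C, hC⟩ := hu.bounded_quarterExt (T + T₀)
    exact ⟨C * T₀, fun x hx t ht => (abs_integral_quarterExt_le hC (by linarith)
      (by linarith) hx).trans_eq (by ring)⟩
  have cw : Continuous fun z : ℝ × ℝ => quarterExt u z.1 (z.2 + T₀) - quarterExt u z.1 z.2 :=
    (cu.comp (f := fun z : ℝ × ℝ => (z.1, z.2 + T₀)) (by fun_prop)).sub cu
  have bw : BoundedUpToTime fun x t => quarterExt u x (t + T₀) - quarterExt u x t := fun T => by
    obtain ⟨C, hC⟩ := hu.bounded_quarterExt (T + T₀)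
    exact ⟨C + C, fun x hx t ht => (abs_sub _ _).trans
      (add_le_add (hC x hx _ (by linarith)) (hC x hx _ (by linarith)))⟩
  have dU : ∀ x t, HasDerivAt (fun t => ∫ s in t..(t + T₀), quarterExt u x s)
      (quarterExt u x (t + T₀) - quarterExt u x t) t := fun x t => by
    simp only [hprim]
    have hc := continuous_slice_right cu x
    have h1 : ∀ t, HasDerivAt (fun t => ∫ s in (0 : ℝ)..t, quarterExt u x s) (quarterExt u x t) t :=
      fun t => (hc.integral_hasStrictDerivAt 0 t).hasDerivAt
    exact ((h1 (t + T₀)).comp_add_const t T₀).sub (h1 t)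
  refine ⟨?_, ?_, fun x hx t ht => ?_⟩
  · have h1 := continuous_bwd_param hκ cU bU
    have h2 := (continuous_bwd_of_integrable hκ (integrable_zeroExt F)
      fun y hy => zeroExt_of_neg F hy).comp (continuous_fst (Y := ℝ))
    exact (continuous_const.mul (cU.sub h1)).add h2
  · intro T
    obtain ⟨C, hC⟩ := bU.sub (bU.bwd hκ) T
    refine ⟨|α * κ| * C + κ * ∫ y, |zeroExt F y|, fun x hx t ht =>
      (abs_add_le _ _).trans (add_le_add ?_ (abs_bwd_le_of_integrable hκ (integrable_zeroExt F) x))⟩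
    rw [abs_mul]
    exact mul_le_mul_of_nonneg_left (hC x hx t ht) (abs_nonneg _)
  · have hw : ∀ y, 0 ≤ y → flowW κ (periodReduced α κ T₀ F u) y t
        = quarterExt u y (t + T₀) - quarterExt u y t := fun y hy => by
      rw [hu.flowW_periodReduced hf hκ hγ hT₀ hgper hfper hy ht.le,
        quarterExt_eq u hy (by positivity), quarterExt_eq u hy ht.le]
    have hq : flowQ κ (periodReduced α κ T₀ F u) x t
        = bwd κ (fun y => quarterExt u y (t + T₀) - quarterExt u y t) x :=
      bwd_congr fun y hy => hw y (hx.trans hy)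
    rw [hw x hx, hq]
    have h1 := (hasDerivAt_integral_exp_mul hκ cU bU cw bw hx ht
      fun y _ t _ => dU y t).const_mul (κ * Real.exp (κ * x))
    exact (((dU x t).sub h1).const_mul (α * κ)).add_const _

end IsLinearBBMSolution

/-! ### Square integrability of the initial value and conclusion -/

/-- Grönwall's inequality in integral form. -/
theorem integral_le_gronwallBound {N : ℝ → ℝ} {A B T : ℝ} (hN : Continuous N) (h0 : ∀ t, 0 ≤ N t)
    (h : ∀ t, 0 ≤ t → t ≤ T → N t ≤ A + B * ∫ s in (0 : ℝ)..t, N s) (hT : 0 ≤ T) :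
    ∫ s in (0 : ℝ)..T, N s ≤ gronwallBound 0 B A T := by
  have hd : ∀ t, HasDerivAt (fun t => ∫ s in (0 : ℝ)..t, N s) (N t) t := fun t =>
    (hN.integral_hasStrictDerivAt 0 t).hasDerivAt
  have := norm_le_gronwallBound_of_norm_deriv_right_le (f := fun t => ∫ s in (0 : ℝ)..t, N s)
    (f' := N) (δ := 0) (K := B) (ε := A) (a := 0) (b := T)
    (fun t _ => (hd t).continuousAt.continuousWithinAt) (fun t _ => (hd t).hasDerivWithinAt)
    (by simp) (fun t ht => by
      rw [Real.norm_of_nonneg (h0 t), Real.norm_of_nonneg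
        (intervalIntegral.integral_nonneg ht.1 fun s _ => h0 s)]
      linarith [h t ht.1 ht.2.le]) T ⟨hT, le_rfl⟩
  rw [sub_zero] at this
  exact (le_abs_self _).trans this

theorem bwd_const_mul_add {κ B C c : ℝ} (hκ : 0 < κ) {p q : ℝ → ℝ} (hp : Continuous p)
    (hq : Continuous q) {x : ℝ} (hB : ∀ y, x ≤ y → |p y| ≤ B) (hC : ∀ y, x ≤ y → |q y| ≤ C) :
    bwd κ (fun y => c * p y + q y) x = c * bwd κ p x + bwd κ q x := by
  unfold bwd
  have h : ∫ y in Ioi x, Real.exp (-κ * y) * (c * p y + q y)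
      = c * (∫ y in Ioi x, Real.exp (-κ * y) * p y) + ∫ y in Ioi x, Real.exp (-κ * y) * q y := by
    rw [← integral_const_mul, ← integral_add
      ((integrableOn_exp_mul_of_bounded hκ hp hB).const_mul c)
      (integrableOn_exp_mul_of_bounded hκ hq hC)]
    exact integral_congr_ae (Eventually.of_forall fun y => by simp only; ring)
  rw [h]
  ring

/-- `p - (1 - κ⁻¹∂)⁻¹ p = -κ⁻¹ (1 - κ⁻¹∂)⁻¹ p'`: the difference of the two sides is bounded and
solves `d' = κ d`. -/
theorem sub_bwd_eq {κ B C : ℝ} (hκ : 0 < κ) {p p' : ℝ → ℝ} (hp : Continuous p)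
    (hp' : Continuous p') (hB : ∀ y, 0 ≤ y → |p y| ≤ B) (hC : ∀ y, 0 ≤ y → |p' y| ≤ C)
    (hd : ∀ y, 0 < y → HasDerivAt p (p' y) y) {x : ℝ} (hx : 0 < x) :
    p x - bwd κ p x = -κ⁻¹ * bwd κ p' x := by
  set d : ℝ → ℝ := fun y => p y - bwd κ p y + κ⁻¹ * bwd κ p' y with hdef
  have h1 : ∀ y, 0 < y → HasDerivAt d (κ * d y) y := fun y hy => by
    refine (((hd y hy).sub (hasDerivAt_bwd hκ hp hB y)).add
      ((hasDerivAt_bwd hκ hp' hC y).const_mul κ⁻¹)).congr_deriv ?_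
    simp only [hdef]
    field_simp
    ring
  have h2 : ∀ y, 0 < y → HasDerivAt (fun y => d y * Real.exp (-κ * y)) 0 y := fun y hy => by
    refine ((h1 y hy).mul (((hasDerivAt_id y).const_mul (-κ)).exp)).congr_deriv ?_
    simp only [id]; ring
  have h3 : ∀ y, 0 < y → d y * Real.exp (-κ * y) = d x * Real.exp (-κ * x) := fun y hy => by
    have := abs_sub_le_of_hasDerivAt (K := 0) h2 (fun _ _ => by simp) hy hx
    rw [zero_mul] at this
    exact sub_eq_zero.1 (abs_nonpos_iff.1 this)
  have h4 : Tendsto (fun y => d y * Real.exp (-κ * y)) atTop (𝓝 0) := by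
    have h5 : Tendsto (fun y => (B + B + κ⁻¹ * C) * Real.exp (-κ * y)) atTop
        (𝓝 ((B + B + κ⁻¹ * C) * 0)) := (Real.tendsto_exp_atBot.comp
          (tendsto_id.const_mul_atTop_of_neg (neg_lt_zero.2 hκ))).const_mul _
    rw [mul_zero] at h5
    refine squeeze_zero_norm' ?_ h5
    filter_upwards [eventually_gt_atTop 0] with y hy
    rw [Real.norm_eq_abs, abs_mul, Real.abs_exp]
    refine mul_le_mul_of_nonneg_right ((abs_add_le _ _).trans (add_le_add ((abs_sub _ _).trans
      (add_le_add (hB y hy.le) (abs_bwd_le hκ fun z hz => hB z (hy.le.trans hz)))) ?_))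
      (Real.exp_pos _).le
    rw [abs_mul, abs_of_pos (inv_pos.2 hκ)]
    exact mul_le_mul_of_nonneg_left (abs_bwd_le hκ fun z hz => hC z (hy.le.trans hz))
      (inv_pos.2 hκ).le
  have h6 : Tendsto (fun y => d y * Real.exp (-κ * y)) atTop (𝓝 (d x * Real.exp (-κ * x))) :=
    tendsto_const_nhds.congr' ((eventually_gt_atTop 0).mono fun y hy => (h3 y hy).symm)
  have h7 := tendsto_nhds_unique h6 h4
  have h8 : d x = 0 := by simpa using h7
  simp only [hdef] at h8
  linarith

/-- For initial data with integrable derivative, `u₀ - (1 - κ⁻¹∂)⁻¹ u₀` is integrable. -/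
theorem exists_integral_abs_sub_bwd_le {κ : ℝ} (hκ : 0 < κ) {u₀ : ℝ → ℝ} (hu₀ : IsCbHalfLine 2 u₀)
    (hu₀' : IntegrableOn (derivWithin u₀ (Ici 0)) (Ici 0)) : ∃ A, ∀ X, 0 ≤ X →
      ∫ x in (0 : ℝ)..X, |u₀ (max x 0) - bwd κ (fun y => u₀ (max y 0)) x| ≤ A := by
  obtain ⟨hC2, hbd⟩ := hu₀
  obtain ⟨B, hB⟩ := hbd 0 (by norm_num)
  obtain ⟨C, hC⟩ := hbd 1 (by norm_num)
  simp only [iteratedDerivWithin_zero] at hB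
  simp only [iteratedDerivWithin_one] at hC
  have hmax : ∀ y : ℝ, max y 0 ∈ Ici (0 : ℝ) := fun y => mem_Ici.2 (le_max_right _ _)
  have hp : Continuous fun y => u₀ (max y 0) :=
    hC2.continuousOn.comp_continuous (by fun_prop) hmax
  have hp' : Continuous fun y => derivWithin u₀ (Ici 0) (max y 0) :=
    (hC2.continuousOn_derivWithin (uniqueDiffOn_Ici 0) (by norm_num)).comp_continuous
      (by fun_prop) hmax
  have hd : ∀ y, 0 < y → HasDerivAt (fun y => u₀ (max y 0)) (derivWithin u₀ (Ici 0) (max y 0)) y :=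
    fun y hy => by
      have h1 : HasDerivAt u₀ (derivWithin u₀ (Ici 0) y) y :=
        ((hC2.differentiableOn (by norm_num)) y hy.le).hasDerivWithinAt.hasDerivAt
          (Ici_mem_nhds hy)
      rw [max_eq_left hy.le]
      refine h1.congr_of_eventuallyEq ?_
      filter_upwards [lt_mem_nhds hy] with z hz
      rw [max_eq_left (le_of_lt hz)]
  set F : ℝ → ℝ := (Ici (0 : ℝ)).indicator (derivWithin u₀ (Ici 0)) with hF
  have hFi : Integrable F := (integrable_indicator_iff measurableSet_Ici).2 hu₀'
  have hF0 : ∀ y, y < 0 → F y = 0 := fun y hy => indicator_of_notMem (by simpa using hy) _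
  refine ⟨κ⁻¹ * ∫ y, |F y|, fun X hX => ?_⟩
  have heq : ∫ x in (0 : ℝ)..X, |u₀ (max x 0) - bwd κ (fun y => u₀ (max y 0)) x|
      = κ⁻¹ * ∫ x in (0 : ℝ)..X, |bwd κ F x| := by
    rw [← intervalIntegral.integral_const_mul, intervalIntegral.integral_of_le hX,
      intervalIntegral.integral_of_le hX]
    refine setIntegral_congr_fun measurableSet_Ioc fun x hx => ?_
    have h1 := sub_bwd_eq hκ hp hp' (fun y _ => hB _ (hmax y)) (fun y _ => hC _ (hmax y)) hd hx.1
    have h2 : bwd κ (fun y => derivWithin u₀ (Ici 0) (max y 0)) x = bwd κ F x :=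
      bwd_congr fun y hy => by
        have : 0 ≤ y := hx.1.le.trans hy
        simp [hF, this]
    simp only [h1, h2, abs_mul, abs_neg, abs_of_pos (inv_pos.2 hκ)]
  rw [heq]
  exact mul_le_mul_of_nonneg_left (integral_abs_bwd_le hκ hFi hF0 hX) (inv_pos.2 hκ).le

namespace IsLinearBBMSolution

variable {α γ κ T₀ : ℝ} {f : ℝ → L1HalfLine} {u₀ g : ℝ → ℝ} {u : ℝ → ℝ → ℝ}

/-- The mass on `[0, X]` of the reduced unknown at time `t` is controlled by the accumulated mass on
`[0, X]` of the deviation `u - u₀`, uniformly in `X`. -/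
theorem exists_integral_abs_reduced_le (hu : IsLinearBBMSolution α γ f u₀ g u)
    (hu₀ : IsCbHalfLine 2 u₀) (hu₀' : IntegrableOn (derivWithin u₀ (Ici 0)) (Ici 0))
    (hf : ContinuousOn f (Ici 0)) (hκ : 0 < κ) (T : ℝ) :
    ∃ A, ∀ X, 0 ≤ X → ∀ t, 0 ≤ t → t ≤ T →
      ∫ x in (0 : ℝ)..X, |α * κ * ((∫ s in (0 : ℝ)..t, quarterExt u x s)
        - bwd κ (fun z => ∫ s in (0 : ℝ)..t, quarterExt u z s) x)
        + bwd κ (zeroExt (∫ s in (0 : ℝ)..t, f s)) x| ≤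
      A + 2 * |α * κ| * ∫ s in (0 : ℝ)..t,
        ∫ x in (0 : ℝ)..X, |quarterExt u x s - quarterExt u x 0| := by
  obtain ⟨A₀, hA₀⟩ := exists_integral_abs_sub_bwd_le hκ hu₀ hu₀'
  obtain ⟨C, hC⟩ := hu.bounded_quarterExt T
  obtain ⟨K, hK⟩ := (isCompact_Icc (a := (0 : ℝ)) (b := T)).exists_bound_of_continuousOn
    (hf.mono fun s hs => hs.1)
  have cu := hu.continuous_quarterExt
  have hu0 : ∀ x, quarterExt u x 0 = u₀ (max x 0) := fun x => by
    simp only [quarterExt, max_self]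
    exact hu.initial _ (mem_Ici.2 (le_max_right _ _))
  have c0 := continuous_slice_left cu 0
  refine ⟨|α * κ| * (T * A₀ + (C + C) * T / κ) + K * T, fun X hX t ht htT => ?_⟩
  have hT : 0 ≤ T := ht.trans htT
  have hC0 : 0 ≤ C := (abs_nonneg _).trans (hC 0 le_rfl T le_rfl)
  have hK0 : 0 ≤ K := (norm_nonneg _).trans (hK 0 ⟨le_rfl, hT⟩)
  set r : ℝ → ℝ → ℝ := fun x s => quarterExt u x s - quarterExt u x 0 with hr
  have cr : Continuous fun z : ℝ × ℝ => r z.1 z.2 := cu.sub (c0.comp continuous_fst)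
  set Q : ℝ → ℝ := fun x => ∫ s in (0 : ℝ)..t, r x s with hQ
  have cQ : Continuous Q :=
    intervalIntegral.continuous_parametric_intervalIntegral_of_continuous' cr 0 t
  have hrC : ∀ x, 0 ≤ x → ∀ s, s ≤ t → |r x s| ≤ C + C := fun x hx s hs =>
    (abs_sub _ _).trans (add_le_add (hC x hx s (hs.trans htT)) (hC x hx 0 hT))
  have hQC : ∀ x, 0 ≤ x → |Q x| ≤ (C + C) * T := fun x hx => by
    have h1 : ‖∫ s in (0 : ℝ)..t, r x s‖ ≤ (C + C) * |t - 0| :=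
      intervalIntegral.norm_integral_le_of_norm_le_const fun s hs => by
        rw [uIoc_of_le ht] at hs
        exact hrC x hx s hs.2
    rw [sub_zero, abs_of_nonneg ht] at h1
    exact h1.trans (by gcongr)
  have hU : ∀ x, ∫ s in (0 : ℝ)..t, quarterExt u x s = t * u₀ (max x 0) + Q x := fun x => by
    have := continuous_slice_right cu x
    simp only [hQ, hr]
    rw [intervalIntegral.integral_sub (this.intervalIntegrable _ _) (by simp),
      intervalIntegral.integral_const, hu0, smul_eq_mul]
    ring
  simp only [hu0] at c0
  have hC' : ∀ y, 0 ≤ y → |u₀ (max y 0)| ≤ C := fun y hy => by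
    rw [← hu0]; exact hC y hy 0 hT
  set F := ∫ s in (0 : ℝ)..t, f s with hF
  have cb0 := continuous_bwd hκ c0 hC'
  have cbQ := continuous_bwd hκ cQ hQC
  have caQ := continuous_bwd hκ cQ.abs (fun y hy => by rw [abs_abs]; exact hQC y hy)
  have cbF := continuous_bwd_of_integrable hκ (integrable_zeroExt F)
    fun y hy => zeroExt_of_neg F hy
  have hpt : ∀ x ∈ Icc 0 X, |α * κ * ((∫ s in (0 : ℝ)..t, quarterExt u x s)
        - bwd κ (fun z => ∫ s in (0 : ℝ)..t, quarterExt u z s) x) + bwd κ (zeroExt F) x|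
      ≤ |α * κ| * (t * |u₀ (max x 0) - bwd κ (fun y => u₀ (max y 0)) x|
        + (|Q x| + bwd κ (fun y => |Q y|) x)) + |bwd κ (zeroExt F) x| := fun x hx => by
    simp only [hU]
    rw [bwd_const_mul_add hκ c0 cQ (fun y hy => hC' y (hx.1.trans hy))
      (fun y hy => hQC y (hx.1.trans hy))]
    refine (abs_add_le _ _).trans (add_le_add ?_ le_rfl)
    rw [abs_mul]
    refine mul_le_mul_of_nonneg_left ?_ (abs_nonneg _)
    have e : t * u₀ (max x 0) + Q x - (t * bwd κ (fun y => u₀ (max y 0)) x + bwd κ Q x)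
        = t * (u₀ (max x 0) - bwd κ (fun y => u₀ (max y 0)) x) + (Q x - bwd κ Q x) := by ring
    rw [e]
    refine (abs_add_le _ _).trans (add_le_add ?_ ?_)
    · rw [abs_mul, abs_of_nonneg ht]
    · exact (abs_sub _ _).trans (add_le_add le_rfl (abs_bwd_le_bwd_abs hκ Q x))
  have cU := hu.continuous_integral_quarterExt 0 t
  have cbU := continuous_bwd hκ cU (fun y hy => abs_integral_quarterExt_le hC ht htT hy)
  have cd : Continuous fun x => t * |u₀ (max x 0) - bwd κ (fun y => u₀ (max y 0)) x| :=
    continuous_const.mul (c0.sub cb0).abs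
  have cs : Continuous fun x => |Q x| + bwd κ (fun y => |Q y|) x := cQ.abs.add caQ
  have cm : Continuous fun x => |α * κ| * (t * |u₀ (max x 0) - bwd κ (fun y => u₀ (max y 0)) x|
      + (|Q x| + bwd κ (fun y => |Q y|) x)) := continuous_const.mul (cd.add cs)
  have ct : Continuous fun x => |α * κ| * (t * |u₀ (max x 0) - bwd κ (fun y => u₀ (max y 0)) x|
      + (|Q x| + bwd κ (fun y => |Q y|) x)) + |bwd κ (zeroExt F) x| := cm.add cbF.abs
  have h1 := intervalIntegral.integral_mono_on (μ := volume) hX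
    (Continuous.intervalIntegrable (by fun_prop) _ _)
    (ct.intervalIntegrable _ _) hpt
  refine h1.trans ?_
  rw [intervalIntegral.integral_add (cm.intervalIntegrable _ _) (cbF.abs.intervalIntegrable _ _),
    intervalIntegral.integral_const_mul,
    intervalIntegral.integral_add (cd.intervalIntegrable _ _) (cs.intervalIntegrable _ _),
    intervalIntegral.integral_const_mul, intervalIntegral.integral_add
      (cQ.abs.intervalIntegrable _ _) (caQ.intervalIntegrable _ _)]
  have k1 := hA₀ X hX
  have k1' : 0 ≤ ∫ x in (0 : ℝ)..X, |u₀ (max x 0) - bwd κ (fun y => u₀ (max y 0)) x| :=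
    intervalIntegral.integral_nonneg hX fun x _ => abs_nonneg _
  have k2 := integral_bwd_le hκ cQ.abs (fun y => abs_nonneg _)
    (fun y hy => by rw [abs_abs]; exact hQC y hy) hX
  have k3 : ∫ x in (0 : ℝ)..X, |bwd κ (zeroExt F) x| ≤ K * T := by
    refine (integral_abs_bwd_le hκ (integrable_zeroExt F)
      (fun y hy => zeroExt_of_neg F hy) hX).trans ?_
    rw [integral_abs_zeroExt]
    have h2 : ‖∫ s in (0 : ℝ)..t, f s‖ ≤ K * |t - 0| :=
      intervalIntegral.norm_integral_le_of_norm_le_const fun s hs => by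
        rw [uIoc_of_le ht] at hs
        exact hK s ⟨hs.1.le, hs.2.trans htT⟩
    rw [sub_zero, abs_of_nonneg ht] at h2
    exact h2.trans (by gcongr)
  have k4 : ∫ x in (0 : ℝ)..X, |Q x| ≤ ∫ s in (0 : ℝ)..t, ∫ x in (0 : ℝ)..X, |r x s| := by
    have cr' : Continuous fun z : ℝ × ℝ => |r z.1 z.2| := cr.abs
    rw [← intervalIntegral_swap_of_continuous cr' 0 X 0 t]
    have cI := intervalIntegral.continuous_parametric_intervalIntegral_of_continuous'
      (μ := volume) (f := fun x s => |r x s|) cr' 0 t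
    exact intervalIntegral.integral_mono_on hX (cQ.abs.intervalIntegrable _ _)
      (cI.intervalIntegrable _ _) fun x _ => intervalIntegral.abs_integral_le_integral_abs ht
  have k5 : t * ∫ x in (0 : ℝ)..X, |u₀ (max x 0) - bwd κ (fun y => u₀ (max y 0)) x| ≤ T * A₀ :=
    mul_le_mul htT k1 k1' hT
  have k6 := mul_le_mul_of_nonneg_left (add_le_add k5 (add_le_add k4 (k2.trans
    (add_le_add k4 le_rfl)))) (abs_nonneg (α * κ))
  linarith

/-- The initial value of the reduced flow is square integrable: it is bounded, and integrable
by Grönwall's inequality for the mass of `u - u₀` on `[0, X]`, with constants independent of `X`. -/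
theorem exists_integral_sq_periodReduced_le (hu : IsLinearBBMSolution α γ f u₀ g u)
    (hu₀ : IsCbHalfLine 2 u₀) (hu₀' : IntegrableOn (derivWithin u₀ (Ici 0)) (Ici 0))
    (hg : ContinuousOn g (Ici 0)) (hf : ContinuousOn f (Ici 0)) (hκ : 0 < κ)
    (hγ : (κ ^ 2)⁻¹ = γ) (hT₀ : 0 < T₀)
    (H : IsReducedFlow κ (α * κ) (periodReduced α κ T₀ (∫ s in (0 : ℝ)..T₀, f s) u)) :
    ∃ E, ∀ X, 0 ≤ X →
      ∫ x in (0 : ℝ)..X, periodReduced α κ T₀ (∫ s in (0 : ℝ)..T₀, f s) u x 0 ^ 2 ≤ E := by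
  obtain ⟨A, hA⟩ := hu.exists_integral_abs_reduced_le hu₀ hu₀' hf hκ T₀
  obtain ⟨C, hC⟩ := hu.bounded_quarterExt T₀
  obtain ⟨K, hK⟩ := (isCompact_Icc (a := (0 : ℝ)) (b := T₀)).exists_bound_of_continuousOn
    (hg.mono fun s hs => hs.1)
  obtain ⟨M, hM⟩ := H.bounded 0
  have cu := hu.continuous_quarterExt
  have c0 := continuous_slice_left cu 0
  have cr : Continuous fun z : ℝ × ℝ => |quarterExt u z.1 z.2 - quarterExt u z.1 0| :=
    (cu.sub (c0.comp continuous_fst)).abs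
  set N : ℝ → ℝ → ℝ := fun X s => ∫ x in (0 : ℝ)..X, |quarterExt u x s - quarterExt u x 0| with hN
  have cN : ∀ X, Continuous (N X) := fun X =>
    intervalIntegral.continuous_parametric_intervalIntegral_of_continuous'
      (f := fun s x => |quarterExt u x s - quarterExt u x 0|)
      (cr.comp (f := fun z : ℝ × ℝ => (z.2, z.1)) (by fun_prop)) 0 X
  have hgron : ∀ X, 0 ≤ X → ∀ t, 0 ≤ t → t ≤ T₀ →
      N X t ≤ ((K + K) / κ + A) + 2 * |α * κ| * ∫ s in (0 : ℝ)..t, N X s := by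
    intro X hX t ht htT
    set η : ℝ → ℝ := fun x => α * κ * ((∫ s in (0 : ℝ)..t, quarterExt u x s)
        - bwd κ (fun z => ∫ s in (0 : ℝ)..t, quarterExt u z s) x)
        + bwd κ (zeroExt (∫ s in (0 : ℝ)..t, f s)) x with hη
    have cU := hu.continuous_integral_quarterExt 0 t
    have cbU := continuous_bwd hκ cU (fun y hy => abs_integral_quarterExt_le hC ht htT hy)
    have cbF := continuous_bwd_of_integrable hκ (integrable_zeroExt (∫ s in (0 : ℝ)..t, f s))
      fun y hy => zeroExt_of_neg _ hy
    have cη : Continuous η := by fun_prop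
    have cfη := continuous_fwd κ cη.abs
    have cE : Continuous fun x => (K + K) * Real.exp (-κ * x) := by fun_prop
    have cs : Continuous fun x => (K + K) * Real.exp (-κ * x) + fwd κ (fun y => |η y|) x :=
      cE.add cfη
    have crt : Continuous fun x => |quarterExt u x t - quarterExt u x 0| :=
      continuous_slice_left (p := fun x s => |quarterExt u x s - quarterExt u x 0|) cr t
    have hpt : ∀ x ∈ Icc 0 X, |quarterExt u x t - quarterExt u x 0|
        ≤ (K + K) * Real.exp (-κ * x) + fwd κ (fun y => |η y|) x := fun x hx => by
      rw [quarterExt_eq u hx.1 ht, quarterExt_eq u hx.1 le_rfl,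
        hu.mild hf hκ hγ le_rfl ht hx.1]
      refine (abs_add_le _ _).trans (add_le_add ?_ (abs_fwd_le_fwd_abs hκ η hx.1))
      rw [abs_mul, Real.abs_exp]
      exact mul_le_mul_of_nonneg_right ((abs_sub _ _).trans (add_le_add (hK t ⟨ht, htT⟩)
        (hK 0 ⟨le_rfl, hT₀.le⟩))) (Real.exp_pos _).le
    have h1 := intervalIntegral.integral_mono_on (μ := volume) hX
      (crt.intervalIntegrable _ _)
      (cs.intervalIntegrable _ _) hpt
    rw [intervalIntegral.integral_add (cE.intervalIntegrable _ _) (cfη.intervalIntegrable _ _),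
      intervalIntegral.integral_const_mul] at h1
    have h2 : ∫ x in (0 : ℝ)..X, Real.exp (-κ * x) ≤ 1 / κ := by
      rw [intervalIntegral.integral_of_le hX]
      have h3 := setIntegral_mono_set (integrableOn_exp_neg_mul hκ 0)
        (Eventually.of_forall fun x => (Real.exp_pos (-κ * x)).le)
        (show Ioc (0 : ℝ) X ⊆ Ioi 0 from Ioc_subset_Ioi_self).eventuallyLE
      rwa [integral_exp_neg_mul hκ, mul_zero, Real.exp_zero] at h3
    have hK0 : 0 ≤ K := (norm_nonneg _).trans (hK 0 ⟨le_rfl, hT₀.le⟩)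
    have h4 := mul_le_mul_of_nonneg_left h2 (add_nonneg hK0 hK0)
    have h5 := integral_fwd_le hκ cη.abs (fun y => abs_nonneg _) hX
    have h6 := hA X hX t ht htT
    have h7 : (K + K) * (1 / κ) = (K + K) / κ := by ring
    linarith
  set G := gronwallBound 0 (2 * |α * κ|) ((K + K) / κ + A) T₀
  have hM0 : 0 ≤ M := (abs_nonneg _).trans (hM 0 le_rfl 0 le_rfl)
  refine ⟨M * (A + 2 * |α * κ| * G), fun X hX => ?_⟩
  have h1 := integral_le_gronwallBound (cN X)
    (fun t => intervalIntegral.integral_nonneg hX fun x _ => abs_nonneg _)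
    (fun t ht htT => hgron X hX t ht htT) hT₀.le
  have h2 := hA X hX T₀ hT₀.le le_rfl
  have ch := continuous_slice_left H.continuous 0
  have h3 : ∫ x in (0 : ℝ)..X, periodReduced α κ T₀ (∫ s in (0 : ℝ)..T₀, f s) u x 0 ^ 2
      ≤ ∫ x in (0 : ℝ)..X, M * |periodReduced α κ T₀ (∫ s in (0 : ℝ)..T₀, f s) u x 0| := by
    refine intervalIntegral.integral_mono_on hX (Continuous.intervalIntegrable (by fun_prop) _ _)
      (Continuous.intervalIntegrable (by fun_prop) _ _) fun x hx => ?_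
    rw [← sq_abs, sq]
    exact mul_le_mul_of_nonneg_right (hM x hx.1 0 le_rfl) (abs_nonneg _)
  refine h3.trans ?_
  rw [intervalIntegral.integral_const_mul]
  refine mul_le_mul_of_nonneg_left ?_ hM0
  simp only [periodReduced, zero_add]
  refine h2.trans (add_le_add le_rfl ?_)
  exact mul_le_mul_of_nonneg_left h1 (by positivity)

end IsLinearBBMSolution

theorem theorem3p1 (α γ : ℝ) (hγ : 0 < γ) (T₀ : ℝ) (hT₀ : 0 < T₀)
    (u₀ : ℝ → ℝ) (hu₀ : IsCbHalfLine 2 u₀)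
    (hu₀' : IntegrableOn (derivWithin u₀ (Ici 0)) (Ici 0))
    (g : ℝ → ℝ) (hg : ContinuousOn g (Ici 0)) (hg0 : g 0 = 0)
    (f : ℝ → L1HalfLine) (hf : ContinuousOn f (Ici 0))
    (hα : α ≠ 0 ∨ ∀ t ∈ Ici (0 : ℝ), f t = 0)
    (hgper : ∀ t ∈ Ici (0 : ℝ), g (t + T₀) = g t)
    (hfper : ∀ t ∈ Ici (0 : ℝ), f (t + T₀) = f t)
    (u : ℝ → ℝ → ℝ) (hu : IsLinearBBMSolution α γ f u₀ g u)
    (x : ℝ) (hx : 0 < x) :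
    Tendsto (fun t => u x (t + T₀) - u x t) atTop (𝓝 0) := by
  obtain ⟨κ, hκ, hκγ⟩ : ∃ κ : ℝ, 0 < κ ∧ (κ ^ 2)⁻¹ = γ :=
    ⟨(√γ)⁻¹, by positivity, by rw [inv_pow, inv_inv, Real.sq_sqrt hγ.le]⟩
  have hw : ∀ t, 0 ≤ t → flowW κ (periodReduced α κ T₀ (∫ s in (0 : ℝ)..T₀, f s) u) x t
      = u x (t + T₀) - u x t := fun t ht =>
    hu.flowW_periodReduced hf hκ hκγ hT₀ hgper hfper hx.le ht
  suffices h : Tendsto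
      (fun t => flowW κ (periodReduced α κ T₀ (∫ s in (0 : ℝ)..T₀, f s) u) x t) atTop (𝓝 0) from
    h.congr' ((eventually_ge_atTop 0).mono hw)
  by_cases hα0 : α = 0
  · -- Without transport and forcing the reduced unknown vanishes identically.
    have hf0 : ∫ s in (0 : ℝ)..T₀, f s = 0 := by
      rw [intervalIntegral.integral_congr (g := fun _ => (0 : L1HalfLine)) fun s hs => ?_,
        intervalIntegral.integral_zero]
      rw [uIcc_of_le hT₀.le] at hs
      exact (hα.resolve_left (not_not.2 hα0)) s hs.1
    have h0 : ∀ y t, periodReduced α κ T₀ (∫ s in (0 : ℝ)..T₀, f s) u y t = 0 := fun y t => by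
      have h1 := abs_bwd_le_of_integrable hκ (integrable_zeroExt (∫ s in (0 : ℝ)..T₀, f s)) y
      rw [integral_abs_zeroExt, hf0, norm_zero, mul_zero, abs_nonpos_iff] at h1
      rw [periodReduced, hα0, hf0, h1]
      ring
    simp only [flowW, h0, fwd, mul_zero, intervalIntegral.integral_zero, tendsto_const_nhds_iff]
  · have H := hu.isReducedFlow_periodReduced hf hκ hκγ hT₀ hgper hfper
    obtain ⟨E, hE⟩ := hu.exists_integral_sq_periodReduced_le hu₀ hu₀' hg hf hκ hκγ hT₀ H
    exact H.tendsto_zero hκ (mul_ne_zero hα0 hκ.ne') hE hx
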